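/- Conventions. An arc is a space homeomorphic to $[0,1]$. A graph is a non-empty metrizable space, not necessarily connected, which is the union of finitely many arcs, any two of which intersect at most in common endpoints. Let $G$ be a graph. A point $x\in G$ is an endpoint of $G$ if $N\smallsetminus\{x\}$ is connected for every connected neighbourhood $N$ of $x$, and a branch point of $G$ if $N\smallsetminus\{x\}$ has at least three components for some connected neighbourhood $N$ of $x$. A set $A\subseteq G$ is regular if it is closed and has finitely many components, each containing more than one point; $\partial$ denotes the boundary in $G$. A regular set $A$ has consistent complement relative to $B\subseteq\partial A$ if each component $C$ of $G\smallsetminus A$ satisfies $\partial C\subseteq B$ or $\partial C\cap B=\emptyset$. Let $\pi:G\times[0,1]\to G$ be the projection. A set $S\subseteq G\times[0,1]$ is straight if $S$ is closed, $\pi$ is one-to-one on $S$ and $\pi(S)$ is regular; its end set is $E(S)=S\cap\pi^{-1}(\partial\pi(S))$. A stairwell structure of height $k$ for $S\subseteq G\times[0,1]$ is a tuple $\langle S_1,\dots,S_k\rangle$ of non-empty straight sets with $S=S_1\cup\dots\cup S_k$ for which there are finite sets $\alpha_i,\beta_i$ ($1\le i\le k$) such that: - $E(S_i)=\alpha_i\cup\beta_i$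 and $\alpha_i\cap\beta_i=\emptyset$ for each $i$, $\alpha_1=\emptyset=\beta_k$, and $\beta_i=\alpha_{i+1}$ for $1\le i<k$; - for $1\le i<k$ there is a neighbourhood $V$ of $\pi(\beta_i)=\pi(\alpha_{i+1})$ in $G$ with $\pi(S_i)\cap V=\pi(S_{i+1})\cap V$; - for each $i$, $\pi(S_i)$ has consistent complement relative to $\pi(\alpha_i)$ and to $\pi(\beta_i)$; - the sets $\pi(\alpha_2),\dots,\pi(\alpha_k)$ are pairwise disjoint and contain no branch point and no endpoint of $G$. A set $M\subseteq G\times(0,1)$ separates $G\times\{0\}$ from $G\times\{1\}$ in $G\times[0,1]$ if $(G\times[0,1])\smallsetminus M=R_0\cup R_1$ with $R_0,R_1$ disjoint, open in $(G\times[0,1])\smallsetminus M$, $G\times\{0\}\subseteq R_0$ and $G\times\{1\}\subseteq R_1$. Theorem. Let $G$ be a graph, let $M\subseteq G\times(0,1)$ be any set which separates $G\times\{0\}$ from $G\times\{1\}$ in $G\times[0,1]$, and let $U\subseteq G\times(0,1)$ be an open set with $M\subseteq U$. Then there exist an odd integer $k$ and a set $S\subseteq U$ which has a stairwell structure of height $k$.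 -/

import Mathlib

open Set Topology

namespace Stairwell

/-- The components of a subset `A` of a space, as subsets of that space. -/
def components {X : Type*} [TopologicalSpace X] (A : Set X) : Set (Set X) :=
  {C | ∃ x ∈ A, C = connectedComponentIn A x}

/-- `M` separates `A` from `B` in `X`: the complement of `M` is the union of two disjoint, relatively
open sets `O₀ \ M` and `O₁ \ M`, the first containing `A` and the second containing `B`. -/
def Separates {X : Type*} [TopologicalSpace X] (M A B : Set X) : Prop :=
  ∃ O₀ O₁ : Set X, IsOpen O₀ ∧ IsOpen O₁ ∧ Mᶜ = (O₀ \ M) ∪ (O₁ \ M) ∧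
    Disjoint (O₀ \ M) (O₁ \ M) ∧ A ⊆ O₀ \ M ∧ B ⊆ O₁ \ M

/-- A (metrizable) space is a graph if it is the union of finitely many arcs, any two of which meet
at most in common endpoints. The arcs are given by embeddings of the unit interval. -/
def IsGraph (G : Type*) [TopologicalSpace G] : Prop :=
  ∃ (n : ℕ) (γ : Fin n → unitInterval → G),
    (∀ i, IsEmbedding (γ i)) ∧ (⋃ i, range (γ i)) = univ ∧
    ∀ i j, i ≠ j → range (γ i) ∩ range (γ j) ⊆ {γ i 0, γ i 1} ∩ {γ j 0, γ j 1}

variable {G : Type*} [TopologicalSpace G]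

/-- `x` is an endpoint: it is not a cutpoint of any connected neighbourhood of `x`. -/
def IsEndpoint (x : G) : Prop :=
  ∀ N ∈ 𝓝 x, IsConnected N → IsPreconnected (N \ {x})

/-- `x` is a branch point: it is a cutpoint of order at least three of some connected
neighbourhood `N` of `x`, that is, `N \ {x}` has at least three components. -/
def IsBranchPoint (x : G) : Prop :=
  ∃ N ∈ 𝓝 x, IsConnected N ∧ 3 ≤ (components (N \ {x})).encard

/-- A regular set: closed, with finitely many components, each of them non-degenerate. -/
def IsRegular (A : Set G) : Prop :=
  IsClosed A ∧ (components A).Finite ∧ ∀ C ∈ components A, C.Nontrivial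

/-- `A` has consistent complement relative to `B` (used for `A` regular and `B ⊆ ∂A`). -/
def HasConsistentComplement (A B : Set G) : Prop :=
  ∀ C ∈ components Aᶜ, frontier C ⊆ B ∨ frontier C ∩ B = ∅

/-- A generic family of finite subsets of `G`. -/
def IsGeneric {ι : Type*} (B : ι → Set G) : Prop :=
  (∀ i, (B i).Finite) ∧ (∀ i, ∀ x ∈ B i, ¬ IsBranchPoint x ∧ ¬ IsEndpoint x) ∧
    ∀ i j, i ≠ j → B i ∩ B j = ∅

/-- The projection `π` of a subset of `G × [0,1]` to `G`. -/
def proj (S : Set (G × unitInterval)) : Set G := Prod.fst '' S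

/-- A straight subset of `G × [0,1]`. -/
def IsStraight (S : Set (G × unitInterval)) : Prop :=
  IsClosed S ∧ InjOn Prod.fst S ∧ IsRegular (proj S)

/-- The end set of a (straight) subset of `G × [0,1]`. -/
def endSet (S : Set (G × unitInterval)) : Set (G × unitInterval) :=
  S ∩ Prod.fst ⁻¹' frontier (proj S)

/-- The tuple `T` of length `k` is a stairwell structure (of height `k`) for `S`. The levels are
indexed by `0, …, k - 1`. -/
def IsStairwellStructure (S : Set (G × unitInterval)) {k : ℕ}
    (T : Fin k → Set (G × unitInterval)) : Prop :=
  (∀ i, (T i).Nonempty ∧ IsStraight (T i)) ∧ S = ⋃ i, T i ∧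
  ∃ α β : Fin k → Set (G × unitInterval),
    -- the end sets are split into two finite parts, linking consecutive levels
    (∀ i, endSet (T i) = α i ∪ β i ∧ Disjoint (α i) (β i) ∧ (α i).Finite ∧ (β i).Finite) ∧
    (∀ i : Fin k, i.val = 0 → α i = ∅) ∧
    (∀ i : Fin k, i.val + 1 = k → β i = ∅) ∧
    (∀ i j : Fin k, i.val + 1 = j.val → β i = α j) ∧
    -- consecutive levels lie on the same side of their common ends
    (∀ i j : Fin k, i.val + 1 = j.val →
      ∃ V ∈ 𝓝ˢ (proj (β i)), proj (T i) ∩ V = proj (T j) ∩ V) ∧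
    (∀ i, HasConsistentComplement (proj (T i)) (proj (α i)) ∧
      HasConsistentComplement (proj (T i)) (proj (β i))) ∧
    IsGeneric (fun i : {i : Fin k // 0 < i.val} => proj (α i.1))

/-- `S` has a stairwell structure of height `k`. -/
def HasStairwellStructure (S : Set (G × unitInterval)) (k : ℕ) : Prop :=
  ∃ T : Fin k → Set (G × unitInterval), IsStairwellStructure S T

end Stairwell

/-!
Write the complement of `U` as the union of two disjoint compact sets `K₀ ⊇ G × {0}` and
`K₁ ⊇ G × {1}`, cut `[0,1]` into `N` small cells, and colour each cell over a point `x` of `G`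
according to whether it comes close to `K₁` or not. The heights at which the colour changes form a
word of odd length, all of whose letters are heights of points of `U` over `x`. Repeating a letter
of the word an even number of times, one may give all these words the same odd length `k`; the
letters are then the heights of `k` levels over `x`.

For nearby points the words need not agree, but they are related by two elementary moves
(`WordMove`): a letter may slide within `U`, and a pair `aa` of equal adjacent letters may be
replaced by another pair `bb`. Indeed, the colourings differ only in cells that lie in `U`; when one
cell is recoloured, either a letter slides across the cell or two adjacent letters, which slide to
one another, appear or disappear (`WordEquiv.colourWord_flip`). The pairs that fill up the words
can be moved to wherever they are needed, as `aab → bbb → baa` (`WordEquiv.pair_cons`).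

Along each arc of the graph the moves are carried out one after the other on small parameter
intervals (`StepChain`). While levels `i` and `i + 1` change from `aa` to `bb`, both are interrupted
over the same open subarc, a gap, at whose two ends they meet. Thus level `i` is the graph of a
continuous function over the complement of finitely many gaps, each of which it shares either with
level `i - 1` or with level `i + 1`. As the gaps have disjoint closures in the interiors of the
arcs, this is a stairwell structure (`exists_hasStairwellStructure_of_gaps`): the components of the
complement of the base of level `i` are its gaps, and the ends shared with level `i - 1` make up
`α i`, those shared with level `i + 1` make up `β i`. The ends of the gaps are neither branch points
nor endpoints (`IsArcDecomposition.not_isBranchPoint`, `IsArcDecomposition.not_isEndpoint`).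
-/

namespace Stairwell

/-! ### Words of heights -/

section

/-- An elementary move between words of heights, where `L` is the set of admissible heights: either
one letter slides along an interval of admissible heights, or two equal adjacent letters are
replaced by another pair of equal letters. -/
inductive WordMove (L : Set ℝ) : List ℝ → List ℝ → Prop
  | slide (u v : List ℝ) (a b : ℝ) (h : uIcc a b ⊆ L) : WordMove L (u ++ a :: v) (u ++ b :: v)
  | switch (u v : List ℝ) (a b : ℝ) (ha : a ∈ L) (hb : b ∈ L) :
      WordMove L (u ++ a :: a :: v) (u ++ b :: b :: v)

/-- Two words are equivalent if elementary moves lead from one to the other. -/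
abbrev WordEquiv (L : Set ℝ) : List ℝ → List ℝ → Prop := Relation.ReflTransGen (WordMove L)

variable {L : Set ℝ}

lemma WordMove.symm {l l' : List ℝ} (h : WordMove L l l') : WordMove L l' l := by
  cases h with
  | slide u v a b h => exact .slide u v b a (by rwa [uIcc_comm])
  | switch u v a b ha hb => exact .switch u v b a hb ha

lemma WordEquiv.symm {l l' : List ℝ} (h : WordEquiv L l l') : WordEquiv L l' l := by
  induction h with
  | refl => exact .refl
  | tail _ h ih => exact .head h.symm ih

lemma WordMove.context {l l' : List ℝ} (s t : List ℝ) (h : WordMove L l l') :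
    WordMove L (s ++ l ++ t) (s ++ l' ++ t) := by
  cases h with
  | slide u v a b h => simpa using WordMove.slide (s ++ u) (v ++ t) a b h
  | switch u v a b ha hb => simpa using WordMove.switch (s ++ u) (v ++ t) a b ha hb

lemma WordEquiv.context {l l' : List ℝ} (s t : List ℝ) (h : WordEquiv L l l') :
    WordEquiv L (s ++ l ++ t) (s ++ l' ++ t) := by
  induction h with
  | refl => exact .refl
  | tail _ h ih => exact ih.tail (h.context s t)

/-- A pair of equal letters moves past any letter, by way of `a a b → b b b → b a a`. -/
lemma WordEquiv.pair_cons {a b : ℝ} (ha : a ∈ L) (hb : b ∈ L) :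
    WordEquiv L [a, a, b] [b, a, a] :=
  .head (WordMove.switch [] [b] a b ha hb) (.single (WordMove.switch [b] [] b a hb ha))

lemma WordEquiv.pair_append {a : ℝ} (ha : a ∈ L) (v : List ℝ) (hv : ∀ x ∈ v, x ∈ L) :
    WordEquiv L (a :: a :: v) (v ++ [a, a]) := by
  induction v with
  | nil => exact .refl
  | cons b v ih =>
    have h1 := (WordEquiv.pair_cons ha (hv b (by simp))).context [] v
    have h2 := (ih fun x hx => hv x (by simp [hx])).context [b] []
    simp only [List.append_nil, List.nil_append, List.cons_append] at h1 h2 ⊢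
    exact h1.trans h2

lemma WordEquiv.replicate {a b : ℝ} (ha : a ∈ L) (hb : b ∈ L) {n : ℕ} (hn : Even n) :
    WordEquiv L (List.replicate n a) (List.replicate n b) := by
  obtain ⟨m, rfl⟩ := hn
  induction m with
  | zero => exact .refl
  | succ m ih =>
    have h1 := WordMove.switch [] (List.replicate (m + m) a) a b ha hb
    have h2 := ih.context [b, b] []
    rw [show m + 1 + (m + 1) = m + m + 1 + 1 by ring]
    simp only [List.append_nil, List.nil_append, List.cons_append, List.replicate_succ] at h1 h2 ⊢
    exact .head h1 h2

/-- The word `l` filled up to length `k` by copies of its first letter. -/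
def padWord (k : ℕ) (l : List ℝ) : List ℝ := l ++ List.replicate (k - l.length) (l.headD 0)

lemma length_padWord {k : ℕ} {l : List ℝ} (h : l.length ≤ k) : (padWord k l).length = k := by
  simp [padWord, h]

lemma headD_mem {l : List ℝ} (hl : l ≠ []) : l.headD 0 ∈ l := by
  cases l with
  | nil => exact absurd rfl hl
  | cons a l => simp

lemma mem_of_mem_padWord {k : ℕ} {l : List ℝ} (hl : l ≠ []) {x : ℝ} (hx : x ∈ padWord k l) :
    x ∈ l := by
  simp only [padWord, List.mem_append] at hx
  rcases hx with hx | hx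
  · exact hx
  · rw [List.eq_of_mem_replicate hx]; exact headD_mem hl

/-- Replacing the letter `a` by the letter `b` inside a word does not change the padded word up to
equivalence if `a` slides to `b`. -/
lemma WordEquiv.padWord_slide {k : ℕ} {u v : List ℝ} {a b : ℝ} (hab : uIcc a b ⊆ L)
    (hu : ∀ x ∈ u, x ∈ L) (hk : Even (k - (u ++ a :: v).length)) :
    WordEquiv L (padWord k (u ++ a :: v)) (padWord k (u ++ b :: v)) := by
  have hlen : (u ++ b :: v).length = (u ++ a :: v).length := by simp
  have hmem : ∀ c ∈ L, (u ++ c :: v).headD 0 ∈ L := by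
    intro c hc
    cases u with
    | nil => simpa using hc
    | cons d u => simpa using hu d (by simp)
  rw [padWord, padWord, hlen]
  have h1 := (WordEquiv.replicate (hmem a (hab left_mem_uIcc)) (hmem b (hab right_mem_uIcc))
    hk).context (u ++ a :: v) []
  have h2 := (WordMove.slide u v a b hab).context []
    (List.replicate (k - (u ++ a :: v).length) ((u ++ b :: v).headD 0))
  simp only [List.append_nil, List.nil_append] at h1 h2
  exact h1.tail h2

/-- Inserting two adjacent letters that slide to one another does not change the padded word up to
equivalence. -/
lemma WordEquiv.padWord_insert {k : ℕ} {u v : List ℝ} {a b : ℝ} (hab : uIcc a b ⊆ L)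
    (hu : ∀ x ∈ u, x ∈ L) (hv : ∀ x ∈ v, x ∈ L) (huv : u ++ v ≠ [])
    (hlen : (u ++ a :: b :: v).length ≤ k) (hk : Even (k - (u ++ a :: b :: v).length)) :
    WordEquiv L (padWord k (u ++ a :: b :: v)) (padWord k (u ++ v)) := by
  have ha : a ∈ L := hab left_mem_uIcc
  have h0 : (u ++ a :: b :: v).headD 0 ∈ L := by
    cases u with
    | nil => simpa using ha
    | cons d u => simpa using hu d (by simp)
  have h0' : (u ++ v).headD 0 ∈ L := by
    have := headD_mem huv
    rcases List.mem_append.1 this with h | h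
    exacts [hu _ h, hv _ h]
  set n := k - (u ++ a :: b :: v).length with hn
  have hn' : k - (u ++ v).length = n + 1 + 1 := by
    simp only [List.length_append, List.length_cons] at hn hlen ⊢; omega
  rw [padWord, padWord, ← hn, hn']
  set p := (u ++ a :: b :: v).headD 0
  set q := (u ++ v).headD 0
  have h1 := ((WordEquiv.replicate h0 h0' hk).context (u ++ a :: b :: v) [])
  have h2 := (WordMove.slide (u ++ [a]) v b a (uIcc_comm a b ▸ hab)).context [] (List.replicate n q)
  have h3 := (WordEquiv.pair_append ha v hv).context u (List.replicate n q)
  have h4 := WordMove.switch (u ++ v) (List.replicate n q) a q ha h0'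
  simp only [List.append_nil, List.nil_append, List.append_assoc, List.cons_append,
    List.replicate_succ] at h1 h2 h3 h4 ⊢
  exact ((h1.tail h2).trans h3).tail h4

/-! ### The word of a colouring -/

/-- Colour the cells `[j / N, (j + 1) / N]`, `j ≤ n`, with two colours. The word of the colouring
lists, in increasing order, the heights at which adjacent cells have different colours. -/
noncomputable def colourWord (N n : ℕ) (c : ℕ → Bool) : List ℝ :=
  ((List.range n).filter fun j => c j != c (j + 1)).map fun j => ((j + 1 : ℕ) : ℝ) / N

lemma length_colourWord_le (N n : ℕ) (c : ℕ → Bool) : (colourWord N n c).length ≤ n := by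
  simpa [colourWord] using (List.length_filter_le (fun j => c j != c (j + 1)) (List.range n))

lemma odd_length_colourWord (N n : ℕ) (c : ℕ → Bool) :
    Odd (colourWord N n c).length ↔ c 0 ≠ c n := by
  induction n with
  | zero => simp [colourWord]
  | succ n ih =>
    have : (colourWord N (n + 1) c).length =
        (colourWord N n c).length + (if c n != c (n + 1) then 1 else 0) := by
      simp only [colourWord, List.range_succ, List.filter_append, List.length_map,
        List.length_append]
      by_cases h : c n = c (n + 1) <;> simp [h]
    rw [this]
    by_cases h : c n = c (n + 1)
    · simp [h, ih]
    · simp only [bne_iff_ne, ne_eq, h, not_false_eq_true, if_true, Nat.odd_add_one, ih]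
      revert h
      cases c 0 <;> cases c n <;> cases c (n + 1) <;> simp

/-- A colouring `c` is admissible for the sets `L₀`, `L₁` of heights if cells of the first colour
lie in `L₁`, and cells of the second colour in `L₀`. -/
def Admissible (L₀ L₁ : Set ℝ) (N n : ℕ) (c : ℕ → Bool) : Prop :=
  ∀ j ≤ n, Icc ((j : ℝ) / N) ((j + 1 : ℕ) / N) ⊆ if c j then L₀ else L₁

variable {L₀ L₁ : Set ℝ}

lemma Admissible.mem_of_mem_colourWord {N n : ℕ} {c : ℕ → Bool} (hc : Admissible L₀ L₁ N n c)
    {x : ℝ} (hx : x ∈ colourWord N n c) : x ∈ L₀ ∩ L₁ := by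
  simp only [colourWord, List.mem_map, List.mem_filter, List.mem_range] at hx
  obtain ⟨j, ⟨hj, hcj⟩, rfl⟩ := hx
  have h1 : ((j + 1 : ℕ) : ℝ) / N ∈ _ := hc j hj.le ⟨by gcongr; omega, le_rfl⟩
  have h2 : ((j + 1 : ℕ) : ℝ) / N ∈ _ := hc (j + 1) hj ⟨le_rfl, by gcongr; omega⟩
  revert hcj h1 h2
  cases c j <;> cases c (j + 1) <;> simp +contextual

/-- Recolouring one cell changes the word of an admissible colouring only up to equivalence. -/
lemma WordEquiv.colourWord_flip {N n k p : ℕ} {c c' : ℕ → Bool} (hc : Admissible L₀ L₁ N n c)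
    (hc' : Admissible L₀ L₁ N n c') (h0 : c 0 ≠ c n) (hp : p + 1 < n)
    (hcc : ∀ j, j ≠ p + 1 → c j = c' j) (hk : Odd k) (hnk : n ≤ k) :
    WordEquiv (L₀ ∩ L₁) (padWord k (colourWord N n c)) (padWord k (colourWord N n c')) := by
  by_cases hpp : c (p + 1) = c' (p + 1)
  · have : c = c' := by
      funext j
      by_cases h : j = p + 1
      exacts [h ▸ hpp, hcc j h]
    rw [this]
  have hn0 : 0 ≠ p + 1 := by omega
  have h0' : c' 0 ≠ c' n := by
    rwa [← hcc 0 hn0, ← hcc n (by omega)]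
  have hodd := (odd_length_colourWord N n c).2 h0
  have hodd' := (odd_length_colourWord N n c').2 h0'
  have hle := (length_colourWord_le N n c).trans hnk
  have hle' := (length_colourWord_le N n c').trans hnk
  have hev := Nat.Odd.sub_odd hk hodd
  have hev' := Nat.Odd.sub_odd hk hodd'
  have hmem := fun x => hc.mem_of_mem_colourWord (x := x)
  have hmem' := fun x => hc'.mem_of_mem_colourWord (x := x)
  -- the recoloured cell is admissible for both colours
  have hcell : uIcc (((p + 1 : ℕ) : ℝ) / N) ((p + 1 + 1 : ℕ) / N) ⊆ L₀ ∩ L₁ := by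
    rw [uIcc_of_le (by gcongr; omega)]
    have e1 := hc (p + 1) hp.le
    have e2 := hc' (p + 1) hp.le
    revert hpp e1 e2
    cases c (p + 1) <;> cases c' (p + 1) <;> simp only [Bool.false_eq_true, if_true, if_false,
      not_true_eq_false, false_imp_iff, not_false_eq_true, true_imp_iff, reduceCtorEq] <;>
      intro e1 e2
    exacts [subset_inter e2 e1, subset_inter e1 e2]
  obtain ⟨q, rfl⟩ : ∃ q, n = p + (2 + q) := ⟨n - p - 2, by omega⟩
  obtain ⟨u, v, hu, hu'⟩ : ∃ u v : List ℝ,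
      (colourWord N (p + (2 + q)) c = u ++ ((if c p = c (p + 1) then [] else
        [((p + 1 : ℕ) : ℝ) / N]) ++ (if c (p + 1) = c (p + 2) then [] else
        [((p + 1 + 1 : ℕ) : ℝ) / N])) ++ v) ∧
      (colourWord N (p + (2 + q)) c' = u ++ ((if c p = c' (p + 1) then [] else
        [((p + 1 : ℕ) : ℝ) / N]) ++ (if c' (p + 1) = c (p + 2) then [] else
        [((p + 1 + 1 : ℕ) : ℝ) / N])) ++ v) := by
    have key : ∀ d : ℕ → Bool, colourWord N (p + (2 + q)) d =
        ((List.range p).filter fun j => d j != d (j + 1)).map (fun j => ((j + 1 : ℕ) : ℝ) / N) ++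
        ((if d p = d (p + 1) then [] else
        [((p + 1 : ℕ) : ℝ) / N]) ++ (if d (p + 1) = d (p + 2) then [] else
        [((p + 1 + 1 : ℕ) : ℝ) / N])) ++
        (((List.range q).map fun x => p + (2 + x)).filter fun j => d j != d (j + 1)).map
          (fun j => ((j + 1 : ℕ) : ℝ) / N) := by
      intro d
      have h2 : List.range 2 = [0, 1] := rfl
      rw [colourWord, List.range_add, List.range_add, h2]
      simp only [List.map_append, List.filter_append, List.map_map, List.append_assoc,
        List.map_cons, List.map_nil, add_zero]
      congr 1
      rw [← List.append_assoc]
      congr 1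
      simp only [List.filter_cons, List.filter_nil, bne_iff_ne, ne_eq, ite_not,
        show p + 1 + 1 = p + 2 from rfl]
      split_ifs <;> rfl
    refine ⟨_, _, key c, ?_⟩
    rw [key c', ← hcc p (by omega), ← hcc (p + 2) (by omega)]
    congr 1
    · congr 2
      refine List.filter_congr fun j hj => ?_
      rw [List.mem_range] at hj
      rw [hcc j (by omega), hcc (j + 1) (by omega)]
    · congr 1
      refine List.filter_congr fun j hj => ?_
      obtain ⟨x, -, rfl⟩ := List.mem_map.1 hj
      rw [hcc _ (by omega), hcc (_ + 1) (by omega)]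
  rw [hu] at hev hle hmem hodd ⊢
  rw [hu'] at hev' hle' hmem' hodd' ⊢
  have hmu : ∀ x ∈ u, x ∈ L₀ ∩ L₁ := fun x hx => hmem x (by simp [hx])
  have hmv : ∀ x ∈ v, x ∈ L₀ ∩ L₁ := fun x hx => hmem x (by simp [hx])
  have hne : ∀ l : List ℝ, Odd l.length → l ≠ [] := by rintro _ h rfl; simp at h
  revert hev hev' hpp hle hle' hodd hodd'
  cases c p <;> cases c (p + 1) <;> cases c' (p + 1) <;> cases c (p + 2) <;>
    simp only [Bool.false_eq_true, if_true, if_false, not_true_eq_false, false_imp_iff,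
      not_false_eq_true, true_imp_iff, reduceCtorEq, List.append_nil, List.nil_append,
      List.append_assoc, List.cons_append] <;> intro hle hle' hev hev' hodd hodd'
  · exact (WordEquiv.padWord_insert hcell hmu hmv (hne _ ‹_›) ‹_› ‹_›).symm
  · exact (WordEquiv.padWord_slide hcell hmu ‹_›).symm
  · exact (WordEquiv.padWord_insert hcell hmu hmv (hne _ ‹_›) ‹_› ‹_›)
  · exact (WordEquiv.padWord_slide hcell hmu ‹_›)
  · exact (WordEquiv.padWord_slide hcell hmu ‹_›)
  · exact (WordEquiv.padWord_insert hcell hmu hmv (hne _ ‹_›) ‹_› ‹_›)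
  · exact (WordEquiv.padWord_slide hcell hmu ‹_›).symm
  · exact (WordEquiv.padWord_insert hcell hmu hmv (hne _ ‹_›) ‹_› ‹_›).symm

/-- Any two admissible colourings that agree on the first and on the last cell have equivalent
words. -/
lemma WordEquiv.colourWord {N n k : ℕ} {c c' : ℕ → Bool} (hc : Admissible L₀ L₁ N n c)
    (hc' : Admissible L₀ L₁ N n c') (h0 : c 0 = false) (hn : c n = true)
    (h0' : c' 0 = false) (hn' : c' n = true) (hk : Odd k) (hnk : n ≤ k) :
    WordEquiv (L₀ ∩ L₁) (padWord k (colourWord N n c)) (padWord k (colourWord N n c')) := by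
  -- change the colours from `c` to `c'` one cell at a time
  let d : ℕ → ℕ → Bool := fun m j => if j ≤ m then c' j else c j
  have hd : ∀ m, Admissible L₀ L₁ N n (d m) := by
    intro m j hj
    by_cases h : j ≤ m
    · simpa [d, h] using hc' j hj
    · simpa [d, h] using hc j hj
  have hd0 : ∀ m, d m 0 = false := fun m => by simp [d, h0']
  have hdn : ∀ m, d m n = true := fun m => by by_cases h : n ≤ m <;> simp [d, h, hn, hn']
  have hw : ∀ e : ℕ → Bool, (∀ j ≤ n, e j = d n j) →
      Stairwell.colourWord N n e = Stairwell.colourWord N n (d n) := by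
    intro e he
    unfold Stairwell.colourWord
    congr 1
    refine List.filter_congr fun j hj => ?_
    rw [List.mem_range] at hj
    rw [he j hj.le, he (j + 1) hj]
  have e1 : c = d 0 := by
    funext j
    rcases j with _ | j <;> simp [d, h0, h0']
  have e2 : Stairwell.colourWord N n c' = Stairwell.colourWord N n (d (n - 1)) := by
    rw [hw c' fun j hj => by simp [d, hj], hw (d (n - 1))]
    intro j hj
    rcases hj.lt_or_eq with h | rfl
    · simp [d, hj, Nat.le_sub_one_of_lt h]
    · rw [hdn, hdn]
  have main : ∀ m, m < n → WordEquiv (L₀ ∩ L₁) (padWord k (Stairwell.colourWord N n (d 0)))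
      (padWord k (Stairwell.colourWord N n (d m))) := by
    intro m
    induction m with
    | zero => exact fun _ => .refl
    | succ m ih =>
      intro hm
      refine (ih (by omega)).trans (WordEquiv.colourWord_flip (p := m) (hd m) (hd (m + 1))
        (by rw [hd0, hdn]; simp) hm (fun j hj => ?_) hk hnk)
      by_cases h : j ≤ m
      · simp [d, h, Nat.le_succ_of_le h]
      · simp [d, h, show ¬ j ≤ m + 1 by omega]
  have : 0 < n := by
    rcases Nat.eq_zero_or_pos n with h | h
    · subst h; simp [h0] at hn
    · exact h
  rw [e2, e1]
  exact main _ (by omega)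

/-! ### Elementary steps -/

/-- A step from the heights `w` to the heights `w'` of `k` levels, with admissible heights `L`. If
`g = some i` then the levels `i` and `i + 1` have equal heights before and after the step and are
interrupted in between; all other levels slide along admissible heights. -/
def IsStep (L : Set ℝ) (k : ℕ) (w w' : ℕ → ℝ) (g : Option ℕ) : Prop :=
  (∀ j < k, w j ∈ L ∧ w' j ∈ L) ∧
  (∀ j < k, (∀ i, g = some i → i ≠ j ∧ i + 1 ≠ j) → uIcc (w j) (w' j) ⊆ L) ∧
  ∀ i, g = some i → i + 1 < k ∧ w i = w (i + 1) ∧ w' i = w' (i + 1)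

lemma IsStep.mono {L L' : Set ℝ} (hL : L ⊆ L') {k : ℕ} {w w' : ℕ → ℝ} {g : Option ℕ}
    (h : IsStep L k w w' g) : IsStep L' k w w' g :=
  ⟨fun j hj => ⟨hL (h.1 j hj).1, hL (h.1 j hj).2⟩, fun j hj hg => (h.2.1 j hj hg).trans hL, h.2.2⟩

/-- The heights of the levels prescribed by a word. -/
def heights (l : List ℝ) : ℕ → ℝ := fun i => l.getD i 0

lemma heights_mem {l : List ℝ} (hl : ∀ x ∈ l, x ∈ L) {j : ℕ} (hj : j < l.length) :
    heights l j ∈ L := by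
  have : heights l j = l[j] := by simp [heights, hj]
  rw [this]; exact hl _ (List.getElem_mem hj)

lemma isStep_self {l : List ℝ} (hl : ∀ x ∈ l, x ∈ L) :
    IsStep L l.length (heights l) (heights l) none := by
  refine ⟨fun j hj => ⟨heights_mem hl hj, heights_mem hl hj⟩, fun j hj _ => ?_, by simp⟩
  simpa using heights_mem hl hj

lemma WordMove.isStep {l l' : List ℝ} (h : WordMove L l l') (hl : ∀ x ∈ l, x ∈ L) :
    l'.length = l.length ∧ (∀ x ∈ l', x ∈ L) ∧
      ∃ g, IsStep L l.length (heights l) (heights l') g := by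
  cases h with
  | slide u v a b h =>
    have hlen : (u ++ b :: v).length = (u ++ a :: v).length := by simp
    have hb : ∀ x ∈ u ++ b :: v, x ∈ L := by
      intro x hx
      simp only [List.mem_append, List.mem_cons] at hx hl
      rcases hx with hx | rfl | hx
      exacts [hl x (.inl hx), h right_mem_uIcc, hl x (.inr (.inr hx))]
    refine ⟨hlen, hb, none, fun j hj => ⟨heights_mem hl hj, heights_mem hb (hlen ▸ hj)⟩,
      fun j hj _ => ?_, by simp⟩
    rcases lt_trichotomy j u.length with hj' | rfl | hj'
    · have e : heights (u ++ b :: v) j = heights (u ++ a :: v) j := by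
        simp [heights, List.getElem?_append, hj']
      rw [e]; simpa using heights_mem hl hj
    · simpa [heights] using h
    · have e : heights (u ++ b :: v) j = heights (u ++ a :: v) j := by
        obtain ⟨m, rfl⟩ : ∃ m, j = u.length + (m + 1) := ⟨j - u.length - 1, by omega⟩
        simp [heights, List.getElem?_append_right]
      rw [e]; simpa using heights_mem hl hj
  | switch u v a b ha hb =>
    have hlen : (u ++ b :: b :: v).length = (u ++ a :: a :: v).length := by simp
    have hb : ∀ x ∈ u ++ b :: b :: v, x ∈ L := by
      intro x hx
      simp only [List.mem_append, List.mem_cons] at hx hl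
      rcases hx with hx | rfl | rfl | hx
      exacts [hl x (.inl hx), hb, hb, hl x (.inr (.inr (.inr hx)))]
    refine ⟨hlen, hb, some u.length, fun j hj => ⟨heights_mem hl hj, heights_mem hb (hlen ▸ hj)⟩,
      fun j hj hg => ?_, ?_⟩
    · obtain ⟨h1, h2⟩ := hg _ rfl
      have e : heights (u ++ b :: b :: v) j = heights (u ++ a :: a :: v) j := by
        rcases lt_or_gt_of_ne h1 with hj' | hj'
        · obtain ⟨m, rfl⟩ : ∃ m, j = u.length + (m + 1 + 1) := ⟨j - u.length - 2, by omega⟩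
          simp [heights, List.getElem?_append_right]
        · simp [heights, List.getElem?_append, hj']
      rw [e]; simpa using heights_mem hl hj
    · rintro i hi
      obtain rfl : u.length = i := by simpa using hi
      simp [heights]

/-- Equivalent words are joined by a non-empty sequence of steps. -/
lemma WordEquiv.transGen_isStep {l l' : List ℝ} (h : WordEquiv L l l') (hl : ∀ x ∈ l, x ∈ L) :
    Relation.TransGen (fun w w' => ∃ g, IsStep L l.length w w' g) (heights l) (heights l') := by
  suffices H : l'.length = l.length ∧ (∀ x ∈ l', x ∈ L) ∧
      Relation.TransGen (fun w w' => ∃ g, IsStep L l.length w w' g) (heights l) (heights l') from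
    H.2.2
  induction h with
  | refl => exact ⟨rfl, hl, .single ⟨none, isStep_self hl⟩⟩
  | tail _ h ih =>
    obtain ⟨h1, h2, h3⟩ := ih
    obtain ⟨h4, h5, h6⟩ := h.isStep h2
    exact ⟨h4.trans h1, h5, h3.tail (h1 ▸ h6)⟩

end

/-! ### Components -/

section Components

variable {X : Type*} [TopologicalSpace X]

lemma connectedComponentIn_eq_of_subset {A s : Set X} (hs : IsPreconnected s) (hsA : s ⊆ A)
    {x y : X} (hx : x ∈ s) (hy : y ∈ s) :
    connectedComponentIn A x = connectedComponentIn A y :=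
  connectedComponentIn_eq (hs.subset_connectedComponentIn hx hsA hy)

lemma components_subset {A C : Set X} (hC : C ∈ components A) : C ⊆ A := by
  obtain ⟨x, -, rfl⟩ := hC
  exact connectedComponentIn_subset A x

lemma eq_of_mem_components {A C D : Set X} (hC : C ∈ components A) (hD : D ∈ components A)
    {x : X} (hxC : x ∈ C) (hxD : x ∈ D) : C = D := by
  obtain ⟨y, -, rfl⟩ := hC
  obtain ⟨z, -, rfl⟩ := hD
  rw [connectedComponentIn_eq hxC, connectedComponentIn_eq hxD]

lemma finite_components {A : Set X} {𝒮 : Set (Set X)} (h𝒮 : 𝒮.Finite)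
    (hpre : ∀ s ∈ 𝒮, IsPreconnected s) (hA : A = ⋃₀ 𝒮) : (components A).Finite := by
  classical
  refine (h𝒮.image fun s => if h : s.Nonempty then connectedComponentIn A h.some else ∅).subset ?_
  rintro C ⟨x, hx, rfl⟩
  obtain ⟨s, hs, hxs⟩ : ∃ s ∈ 𝒮, x ∈ s := by simpa [hA] using hx
  have hne : s.Nonempty := ⟨x, hxs⟩
  refine ⟨s, hs, ?_⟩
  simp only [hne, dif_pos]
  exact connectedComponentIn_eq_of_subset (hpre s hs) (hA ▸ subset_sUnion_of_mem hs)
    hne.some_mem hxs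

lemma nontrivial_of_mem_components {A : Set X} {𝒮 : Set (Set X)}
    (hpre : ∀ s ∈ 𝒮, IsPreconnected s) (hnt : ∀ s ∈ 𝒮, s.Nontrivial) (hA : A = ⋃₀ 𝒮)
    {C : Set X} (hC : C ∈ components A) : C.Nontrivial := by
  obtain ⟨x, hx, rfl⟩ := hC
  obtain ⟨s, hs, hxs⟩ : ∃ s ∈ 𝒮, x ∈ s := by simpa [hA] using hx
  exact (hnt s hs).mono
    ((hpre s hs).subset_connectedComponentIn hxs (hA ▸ subset_sUnion_of_mem hs))

/-- The components of a union of disjoint connected open sets are among these sets. -/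
lemma eq_of_mem_components_iUnion {ι : Type*} {C : ι → Set X} (hCo : ∀ g, IsOpen (C g))
    (hCc : ∀ g, IsPreconnected (C g)) (hdisj : Pairwise fun g h => Disjoint (C g) (C h))
    {J : Set ι} {D : Set X} (hD : D ∈ components (⋃ g ∈ J, C g)) : ∃ g ∈ J, D = C g := by
  obtain ⟨x, hx, rfl⟩ := hD
  obtain ⟨g, hg, hxg⟩ : ∃ g ∈ J, x ∈ C g := by simpa using hx
  refine ⟨g, hg, Subset.antisymm ?_ ((hCc g).subset_connectedComponentIn hxg
    (subset_biUnion_of_mem (u := C) hg))⟩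
  refine isPreconnected_connectedComponentIn.subset_left_of_subset_union (hCo g)
    (v := ⋃ h ∈ {h | h ≠ g}, C h) (isOpen_biUnion fun h _ => hCo h) ?_ ?_
    ⟨x, mem_connectedComponentIn hx, hxg⟩
  · exact disjoint_iUnion₂_right.2 fun h hh => hdisj (Ne.symm hh)
  · intro y hy
    obtain ⟨h, -, hyh⟩ : ∃ h ∈ J, y ∈ C h := by simpa using connectedComponentIn_subset _ _ hy
    by_cases e : h = g
    · exact .inl (e ▸ hyh)
    · exact .inr (mem_biUnion (show h ∈ {h | h ≠ g} from e) hyh)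

lemma frontier_biUnion_of_disjoint_closure {ι : Type*} [Finite ι] {C : ι → Set X}
    (hCo : ∀ g, IsOpen (C g)) (hdisj : Pairwise fun g h => Disjoint (closure (C g)) (closure (C h)))
    (J : Set ι) : frontier (⋃ g ∈ J, C g) = ⋃ g ∈ J, frontier (C g) := by
  rw [(isOpen_biUnion fun g _ => hCo g).frontier_eq, J.toFinite.closure_biUnion]
  ext x
  simp only [(hCo _).frontier_eq, mem_sdiff, mem_iUnion, not_exists]
  constructor
  · rintro ⟨⟨g, hg, hx⟩, h⟩
    exact ⟨g, hg, hx, h g hg⟩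
  · rintro ⟨g, hg, hx, h⟩
    refine ⟨⟨g, hg, hx⟩, fun g' hg' hx' => ?_⟩
    by_cases e : g = g'
    · exact h (e ▸ hx')
    · exact (hdisj e).le_bot ⟨hx, subset_closure hx'⟩

end Components

/-! ### Stairwell structures from gaps -/

section Gaps

variable {G : Type*} {ι : Type*}

/-- The part of `G` over which level `i` is defined: a gap `C g` of level `lev g` is removed from
the two consecutive levels `lev g` and `lev g + 1`. -/
def levelBase (lev : ι → ℕ) (C : ι → Set G) (i : ℕ) : Set G :=
  (⋃ g ∈ {g | lev g = i ∨ lev g + 1 = i}, C g)ᶜ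

/-- The part over `Q` of the graph of `f`, as a subset of `G × [0,1]`. -/
def graphOver (f : G → ℝ) (Q : Set G) : Set (G × unitInterval) := {p | p.1 ∈ Q ∧ (p.2 : ℝ) = f p.1}

lemma injOn_graphOver (f : G → ℝ) (Q : Set G) : InjOn Prod.fst (graphOver f Q) := by
  rintro ⟨x, s⟩ ⟨-, hs⟩ ⟨y, t⟩ ⟨-, ht⟩ (rfl : x = y)
  exact Prod.ext rfl (Subtype.ext (hs.trans ht.symm))

lemma proj_graphOver {f : G → ℝ} {Q : Set G} (h : ∀ x ∈ Q, ∃ s : unitInterval, (s : ℝ) = f x) :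
    proj (graphOver f Q) = Q := by
  ext x
  constructor
  · rintro ⟨p, hp, rfl⟩; exact hp.1
  · intro hx
    obtain ⟨s, hs⟩ := h x hx
    exact ⟨(x, s), ⟨hx, hs⟩, rfl⟩

lemma graphOver_congr {f f' : G → ℝ} {Q : Set G} (h : ∀ x ∈ Q, f x = f' x) :
    graphOver f Q = graphOver f' Q := by
  ext p
  exact and_congr_right fun hp => by rw [h _ hp]

lemma finite_graphOver (f : G → ℝ) {Q : Set G} (hQ : Q.Finite) : (graphOver f Q).Finite :=
  Finite.of_finite_image (hQ.subset (by rintro _ ⟨p, hp, rfl⟩; exact hp.1)) (injOn_graphOver f Q)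

/-- Continuous functions `f 0, …, f (k - 1)` and a finite system of gaps yield a stairwell structure
of height `k`: level `i` is the graph of `f i` over the complement of the gaps of the levels `i`
and `i - 1`, and the gaps of level `i` are where levels `i` and `i + 1` end at common points. -/
theorem exists_hasStairwellStructure_of_gaps [TopologicalSpace G] [Finite ι] {k : ℕ}
    {lev : ι → ℕ} {C : ι → Set G} {f : ℕ → G → ℝ} {U : Set (G × unitInterval)}
    (hCo : ∀ g, IsOpen (C g)) (hCc : ∀ g, IsPreconnected (C g))
    (hdisj : Pairwise fun g h => Disjoint (closure (C g)) (closure (C h)))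
    (hfin : ∀ g, (frontier (C g)).Finite)
    (hgen : ∀ g, ∀ x ∈ frontier (C g), ¬ IsBranchPoint x ∧ ¬ IsEndpoint x)
    (hlev : ∀ g, lev g + 1 < k) (hf : ∀ i < k, Continuous (f i))
    (hagree : ∀ g, ∀ x ∈ frontier (C g), f (lev g) x = f (lev g + 1) x)
    (hreg : ∀ i < k, IsRegular (levelBase lev C i))
    (hne : ∀ i < k, (levelBase lev C i).Nonempty)
    (hU : ∀ i < k, ∀ x ∈ levelBase lev C i, ∃ s : unitInterval, (s : ℝ) = f i x ∧ (x, s) ∈ U) :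
    ∃ S ⊆ U, HasStairwellStructure S k := by
  classical
  set A := levelBase lev C with hA
  have hUs : ∀ i < k, ∀ x ∈ A i, ∃ s : unitInterval, (s : ℝ) = f i x := fun i hi x hx =>
    (hU i hi x hx).imp fun s hs => hs.1
  -- the common ends of the levels `j` and `j + 1`
  let E : ℕ → Set G := fun j => ⋃ g ∈ {g | lev g = j}, frontier (C g)
  let E' : ℕ → Set G := fun j => ⋃ g ∈ {g | lev g + 1 = j}, frontier (C g)
  have hEE' : ∀ j, E' (j + 1) = E j := fun j => by simp [E, E']
  have hE'0 : E' 0 = ∅ := by simp [E']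
  have hEfin : ∀ j, (E j).Finite := fun j => (toFinite _).biUnion fun g _ => hfin g
  have hE'fin : ∀ j, (E' j).Finite := fun j => (toFinite _).biUnion fun g _ => hfin g
  have hfcl : ∀ g, frontier (C g) ⊆ closure (C g) := fun g => frontier_subset_closure
  have hfeq : ∀ {g h x}, x ∈ frontier (C g) → x ∈ closure (C h) → g = h := by
    intro g h x hg hh
    by_contra e
    exact (hdisj e).le_bot ⟨hfcl g hg, hh⟩
  have hfr : ∀ i, frontier (A i) = E' i ∪ E i := by
    intro i
    rw [hA, levelBase, frontier_compl, frontier_biUnion_of_disjoint_closure hCo hdisj]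
    ext x
    simp only [E, E', mem_ofPred_eq, mem_iUnion, mem_union, exists_prop]
    constructor
    · rintro ⟨g, hg | hg, hx⟩
      exacts [.inr ⟨g, hg, hx⟩, .inl ⟨g, hg, hx⟩]
    · rintro (⟨g, hg, hx⟩ | ⟨g, hg, hx⟩)
      exacts [⟨g, .inr hg, hx⟩, ⟨g, .inl hg, hx⟩]
  have hAcl : ∀ i, IsClosed (A i) := fun i =>
    (isOpen_biUnion fun g _ => hCo g).isClosed_compl
  have hfrA : ∀ i, E' i ∪ E i ⊆ A i := fun i => hfr i ▸ (hAcl i).frontier_subset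
  have hEd : ∀ j j', j ≠ j' → E j ∩ E j' = ∅ := by
    intro j j' hjj
    refine eq_empty_iff_forall_notMem.2 ?_
    rintro x ⟨hx, hx'⟩
    simp only [E, mem_ofPred_eq, mem_iUnion, exists_prop] at hx hx'
    obtain ⟨g, rfl, hx⟩ := hx
    obtain ⟨h, rfl, hx'⟩ := hx'
    exact hjj (by rw [hfeq hx (hfcl h hx')])
  have hE'E : ∀ j, E' j ∩ E j = ∅ := by
    rintro (_ | j)
    · simp [hE'0]
    · rw [hEE']; exact hEd _ _ (by omega)
  have hEk : ∀ j, k ≤ j + 1 → E j = ∅ := by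
    intro j hj
    refine eq_empty_iff_forall_notMem.2 fun x hx => ?_
    simp only [E, mem_ofPred_eq, mem_iUnion, exists_prop] at hx
    obtain ⟨g, rfl, -⟩ := hx
    exact absurd (hlev g) (by omega)
  let T : Fin k → Set (G × unitInterval) := fun i => graphOver (f i) (A i)
  have hpT : ∀ i, proj (T i) = A i := fun i => proj_graphOver (hUs i i.2)
  have hpα : ∀ i : Fin k, proj (graphOver (f i) (E' i)) = E' i := fun i =>
    proj_graphOver fun x hx => hUs i i.2 x (hfrA i (.inl hx))
  have hpβ : ∀ i : Fin k, proj (graphOver (f i) (E i)) = E i := fun i =>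
    proj_graphOver fun x hx => hUs i i.2 x (hfrA i (.inr hx))
  refine ⟨⋃ i, T i, iUnion_subset fun i => ?_, T, ?_, rfl, fun i => graphOver (f i) (E' i),
    fun i => graphOver (f i) (E i), ?_, ?_, ?_, ?_, ?_, ?_, ?_⟩
  · rintro ⟨x, s⟩ ⟨hx, hs⟩
    obtain ⟨s', hs', h⟩ := hU i i.2 x hx
    rwa [show s = s' from Subtype.ext (hs.trans hs'.symm)]
  · intro i
    refine ⟨?_, ?_, injOn_graphOver _ _, by rw [hpT]; exact hreg i i.2⟩
    · obtain ⟨x, hx⟩ := hne i i.2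
      obtain ⟨s, hs⟩ := hUs i i.2 x hx
      exact ⟨(x, s), hx, hs⟩
    · exact ((hAcl i).preimage continuous_fst).inter (isClosed_eq
        (continuous_subtype_val.comp continuous_snd) ((hf i i.2).comp continuous_fst))
  · intro i
    refine ⟨?_, ?_, finite_graphOver _ (hE'fin i), finite_graphOver _ (hEfin i)⟩
    · rw [endSet, hpT, hfr]
      ext p
      constructor
      · rintro ⟨hp, h | h⟩
        exacts [.inl ⟨h, hp.2⟩, .inr ⟨h, hp.2⟩]
      · rintro (h | h)
        exacts [⟨⟨hfrA i (.inl h.1), h.2⟩, .inl h.1⟩, ⟨⟨hfrA i (.inr h.1), h.2⟩, .inr h.1⟩]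
    · refine disjoint_left.2 fun p hp hp' => ?_
      exact (eq_empty_iff_forall_notMem.1 (hE'E i)) p.1 ⟨hp.1, hp'.1⟩
  · intro i hi
    simp only [hi, hE'0]
    exact eq_empty_of_forall_notMem fun p hp => hp.1
  · intro i hi
    simp only [hEk i hi.ge]
    exact eq_empty_of_forall_notMem fun p hp => hp.1
  · intro i j hij
    simp only [← hij, hEE']
    refine graphOver_congr fun x hx => ?_
    simp only [E, mem_ofPred_eq, mem_iUnion, exists_prop] at hx
    obtain ⟨g, hg, hx⟩ := hx
    rw [← hg]; exact hagree g x hx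
  · intro i j hij
    refine ⟨(⋃ g ∈ {g | lev g ≠ i}, closure (C g))ᶜ, ?_, ?_⟩
    · refine ((toFinite _).isClosed_biUnion fun g _ => isClosed_closure).isOpen_compl.mem_nhdsSet.2
        ?_
      rw [hpβ]
      intro x hx hx'
      simp only [E, mem_ofPred_eq, mem_iUnion, exists_prop] at hx hx'
      obtain ⟨g, hg, hx⟩ := hx
      obtain ⟨h, hh, hx'⟩ := hx'
      exact hh (hfeq hx hx' ▸ hg)
    · rw [hpT, hpT]
      -- away from the other gaps, both bases are the complement of the gaps of level `i`
      have key : ∀ m : ℕ, (m = i ∨ m = i + 1) → ∀ x,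
          x ∈ (⋃ g ∈ {g | lev g ≠ i}, closure (C g))ᶜ →
          (x ∈ A m ↔ ∀ g, lev g = i → x ∉ C g) := by
        intro m hm x hx
        simp only [mem_compl_iff, mem_iUnion, mem_ofPred_eq, exists_prop, not_exists,
          not_and] at hx
        simp only [hA, levelBase, mem_compl_iff, mem_iUnion, mem_ofPred_eq, exists_prop,
          not_exists, not_and]
        constructor
        · intro h g hg
          exact h g (by omega)
        · intro h g _ hxg
          by_cases e : lev g = i
          · exact h g e hxg
          · exact hx g e (subset_closure hxg)
      ext x
      constructor
      · rintro ⟨h, hx⟩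
        exact ⟨(key j (.inr hij.symm) x hx).2 ((key i (.inl rfl) x hx).1 h), hx⟩
      · rintro ⟨h, hx⟩
        exact ⟨(key i (.inl rfl) x hx).2 ((key j (.inr hij.symm) x hx).1 h), hx⟩
  · intro i
    rw [hpT, hpα, hpβ]
    have key : ∀ D ∈ components (A i)ᶜ, ∃ g, (lev g = i ∨ lev g + 1 = i) ∧ D = C g := by
      intro D hD
      rw [hA, levelBase, compl_compl] at hD
      exact eq_of_mem_components_iUnion hCo hCc
        (fun g h hgh => (hdisj hgh).mono subset_closure subset_closure) hD
    constructor
    · intro D hD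
      obtain ⟨g, hg, rfl⟩ := key D hD
      by_cases h : lev g + 1 = i
      · exact .inl (subset_biUnion_of_mem (u := fun g => frontier (C g)) h)
      · refine .inr (eq_empty_of_forall_notMem ?_)
        rintro x ⟨hx, hx'⟩
        simp only [E', mem_ofPred_eq, mem_iUnion, exists_prop] at hx'
        obtain ⟨g', hg', hx'⟩ := hx'
        exact h (hfeq hx (hfcl g' hx') ▸ hg')
    · intro D hD
      obtain ⟨g, hg, rfl⟩ := key D hD
      by_cases h : lev g = i
      · exact .inl (subset_biUnion_of_mem (u := fun g => frontier (C g)) h)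
      · refine .inr (eq_empty_of_forall_notMem ?_)
        rintro x ⟨hx, hx'⟩
        simp only [E, mem_ofPred_eq, mem_iUnion, exists_prop] at hx'
        obtain ⟨g', hg', hx'⟩ := hx'
        exact h (hfeq hx (hfcl g' hx') ▸ hg')
  · refine ⟨fun i => ?_, fun i x hx => ?_, fun i j hij => ?_⟩
    · simpa only [hpα] using hE'fin i.1
    · simp only [hpα] at hx
      simp only [E', mem_ofPred_eq, mem_iUnion, exists_prop] at hx
      obtain ⟨g, -, hx⟩ := hx
      exact hgen g x hx
    · simp only [hpα]
      have hi := i.2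
      have hj := j.2
      have hne : (i.1.val : ℕ) ≠ j.1.val := fun h => hij (Subtype.ext (Fin.ext h))
      rw [show (i.1.val : ℕ) = i.1.val - 1 + 1 by omega,
        show (j.1.val : ℕ) = j.1.val - 1 + 1 by omega, hEE', hEE']
      exact hEd _ _ (by omega)

end Gaps

/-! ### Arcs of a graph -/

section

section FiniteUnions

variable {X Y : Type*} [TopologicalSpace X] [TopologicalSpace Y]

/-- `A` is the union of finitely many connected sets. -/
def IsFiniteUnionOfConnected (A : Set X) : Prop :=
  ∃ 𝒮 : Set (Set X), 𝒮.Finite ∧ (∀ s ∈ 𝒮, IsPreconnected s) ∧ A = ⋃₀ 𝒮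

lemma IsFiniteUnionOfConnected.of_isPreconnected {A : Set X} (hA : IsPreconnected A) :
    IsFiniteUnionOfConnected A :=
  ⟨{A}, finite_singleton A, by simpa using hA, by simp⟩

lemma IsFiniteUnionOfConnected.iUnion {ι : Type*} [Finite ι] {A : ι → Set X}
    (hA : ∀ i, IsFiniteUnionOfConnected (A i)) : IsFiniteUnionOfConnected (⋃ i, A i) := by
  choose 𝒮 h1 h2 h3 using hA
  refine ⟨⋃ i, 𝒮 i, finite_iUnion h1, fun s hs => ?_, ?_⟩
  · obtain ⟨i, hi⟩ := mem_iUnion.1 hs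
    exact h2 i s hi
  · rw [sUnion_iUnion]
    exact iUnion_congr h3

lemma IsFiniteUnionOfConnected.union {A B : Set X} (hA : IsFiniteUnionOfConnected A)
    (hB : IsFiniteUnionOfConnected B) : IsFiniteUnionOfConnected (A ∪ B) := by
  rw [union_eq_iUnion]
  exact .iUnion (by rintro (_ | _) <;> assumption)

lemma IsFiniteUnionOfConnected.image {A : Set X} (hA : IsFiniteUnionOfConnected A) {f : X → Y}
    (hf : Continuous f) : IsFiniteUnionOfConnected (f '' A) := by
  obtain ⟨𝒮, h1, h2, rfl⟩ := hA
  refine ⟨Set.image f '' 𝒮, h1.image _, ?_, image_sUnion⟩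
  rintro _ ⟨s, hs, rfl⟩
  exact (h2 s hs).image f hf.continuousOn

/-- If `N` is connected and `N \ {x}` has finitely many components, then each of them accumulates
at `x`. -/
lemma mem_closure_of_mem_components [T1Space X] {N : Set X} (hN : IsPreconnected N) {x : X}
    (hx : x ∈ N) (hfin : IsFiniteUnionOfConnected (N \ {x})) {C : Set X}
    (hC : C ∈ components (N \ {x})) : x ∈ closure C := by
  by_contra hxC
  obtain ⟨𝒮, h𝒮, hpre, hun⟩ := hfin
  have hcfin := finite_components h𝒮 hpre hun
  -- components are relatively closed
  have hcl : ∀ D ∈ components (N \ {x}), closure D ∩ (N \ {x}) ⊆ D := by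
    rintro D hD z ⟨hz, hz'⟩
    have hDs := components_subset hD
    obtain ⟨y, hy, rfl⟩ := hD
    have h1 : IsPreconnected (closure (connectedComponentIn (N \ {x}) y) ∩ (N \ {x})) :=
      isPreconnected_connectedComponentIn.subset_closure
        (fun w hw => ⟨subset_closure hw, hDs hw⟩) inter_subset_left
    exact h1.subset_connectedComponentIn
      ⟨subset_closure (mem_connectedComponentIn hy), hy⟩ inter_subset_right ⟨hz, hz'⟩
  -- so `C` and the union of `{x}` with the other components disconnect `N`
  let R : Set X := {x} ∪ ⋃ D ∈ components (N \ {x}) \ {C}, closure D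
  have hR : IsClosed R := isClosed_singleton.union
    ((hcfin.subset sdiff_subset).isClosed_biUnion fun D _ => isClosed_closure)
  have hcov : N ⊆ closure C ∪ R := by
    intro z hz
    by_cases e : z = x
    · exact .inr (.inl e)
    · have hz' : z ∈ N \ {x} := ⟨hz, e⟩
      have hzD : connectedComponentIn (N \ {x}) z ∈ components (N \ {x}) := ⟨z, hz', rfl⟩
      have hzz := subset_closure (mem_connectedComponentIn hz')
      by_cases e' : connectedComponentIn (N \ {x}) z = C
      · exact .inl (e' ▸ hzz)
      · exact .inr (.inr (mem_iUnion₂.2 ⟨_, ⟨hzD, e'⟩, hzz⟩))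
  have hCne : (N ∩ closure C).Nonempty := by
    have hCs := components_subset hC
    obtain ⟨y, hy, rfl⟩ := hC
    exact ⟨y, hy.1, subset_closure (mem_connectedComponentIn hy)⟩
  obtain ⟨z, hzN, hzC, hzR⟩ := (isPreconnected_closed_iff.1 hN) _ _ isClosed_closure hR hcov hCne
    ⟨x, hx, .inl rfl⟩
  have hzx : z ≠ x := fun e => hxC (e ▸ hzC)
  have hz' : z ∈ N \ {x} := ⟨hzN, hzx⟩
  rcases hzR with hzR | hzR
  · exact hzx hzR
  · obtain ⟨D, hD, hzD⟩ : ∃ D ∈ components (N \ {x}) \ {C}, z ∈ closure D := by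
      simpa only [mem_iUnion, exists_prop] using hzR
    exact hD.2 (eq_of_mem_components hD.1 hC (hcl D hD.1 ⟨hzD, hz'⟩) (hcl C hC ⟨hzC, hz'⟩))

end FiniteUnions

variable {G : Type*} [TopologicalSpace G]

/-- The arcs `γ 0, …, γ (n - 1)` exhibit `G` as a graph. -/
structure IsArcDecomposition {n : ℕ} (γ : Fin n → unitInterval → G) : Prop where
  isEmbedding : ∀ e, IsEmbedding (γ e)
  iUnion_range : ⋃ e, range (γ e) = univ
  inter : ∀ i j, i ≠ j → range (γ i) ∩ range (γ j) ⊆ {γ i 0, γ i 1} ∩ {γ j 0, γ j 1}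

namespace IsArcDecomposition

variable {n : ℕ} {γ : Fin n → unitInterval → G} (hγ : IsArcDecomposition γ)

include hγ

lemma continuous (e : Fin n) : Continuous (γ e) := (hγ.isEmbedding e).continuous

lemma injective (e : Fin n) : Function.Injective (γ e) := (hγ.isEmbedding e).injective

lemma exists_eq (x : G) : ∃ e t, γ e t = x := by
  simpa using (hγ.iUnion_range.symm ▸ mem_univ x : x ∈ ⋃ e, range (γ e))

lemma compactSpace : CompactSpace G :=
  ⟨hγ.iUnion_range ▸ isCompact_iUnion fun e => isCompact_range (hγ.continuous e)⟩

lemma eq_of_mem_Ioo {e e' : Fin n} {s t : unitInterval} (hs : s ∈ Ioo 0 1)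
    (h : γ e s = γ e' t) : e = e' ∧ s = t := by
  have he : e = e' := by
    by_contra he
    rcases (hγ.inter e e' he ⟨⟨s, rfl⟩, ⟨t, h.symm⟩⟩).1 with h' | h'
    · exact hs.1.ne' (hγ.injective e h')
    · exact hs.2.ne (hγ.injective e h')
  subst he
  exact ⟨rfl, hγ.injective e h⟩

lemma isOpen_image_Ioo [T2Space G] (e : Fin n) (a b : unitInterval) :
    IsOpen (γ e '' Ioo a b) := by
  have : γ e '' Ioo a b = ((⋃ e' ∈ {e' | e' ≠ e}, range (γ e')) ∪ γ e '' (Ioo a b)ᶜ)ᶜ := by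
    ext x
    simp only [mem_compl_iff, mem_union, mem_iUnion, mem_ofPred_eq, exists_prop, not_or]
    constructor
    · rintro ⟨t, ht, rfl⟩
      have ht' : t ∈ Ioo 0 1 := ⟨bot_le.trans_lt ht.1, ht.2.trans_le le_top⟩
      refine ⟨?_, ?_⟩
      · rintro ⟨e', he', s, hs⟩
        exact he' (hγ.eq_of_mem_Ioo ht' hs.symm).1.symm
      · rintro ⟨s, hs, hst⟩
        exact hs ((hγ.injective e hst).symm ▸ ht)
    · rintro ⟨h1, h2⟩
      obtain ⟨e', t, rfl⟩ := hγ.exists_eq x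
      obtain rfl : e' = e := by
        by_contra h; exact h1 ⟨e', h, t, rfl⟩
      refine ⟨t, ?_, rfl⟩
      by_contra h
      exact h2 ⟨t, h, rfl⟩
  rw [this]
  refine (IsClosed.union ((toFinite _).isClosed_biUnion fun e' _ => ?_) ?_).isOpen_compl
  · exact (isCompact_range (hγ.continuous e')).isClosed
  · exact (isOpen_Ioo.isClosed_compl.isCompact.image (hγ.continuous e)).isClosed

lemma isClosed_image_Icc [T2Space G] (e : Fin n) (a b : unitInterval) :
    IsClosed (γ e '' Icc a b) :=
  (isClosed_Icc.isCompact.image (hγ.continuous e)).isClosed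

lemma closure_image_Ioo_subset [T2Space G] (e : Fin n) (a b : unitInterval) :
    closure (γ e '' Ioo a b) ⊆ γ e '' Icc a b :=
  closure_minimal (image_mono Ioo_subset_Icc_self) (hγ.isClosed_image_Icc e a b)

lemma frontier_image_Ioo_subset [T2Space G] (e : Fin n) (a b : unitInterval) :
    frontier (γ e '' Ioo a b) ⊆ {γ e a, γ e b} := by
  rw [(hγ.isOpen_image_Ioo e a b).frontier_eq]
  rintro x ⟨hx, hx'⟩
  obtain ⟨t, ht, rfl⟩ := hγ.closure_image_Ioo_subset e a b hx
  rcases ht.1.eq_or_lt with rfl | h1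
  · exact .inl rfl
  rcases ht.2.eq_or_lt with rfl | h2
  · exact .inr rfl
  exact absurd ⟨t, ⟨h1, h2⟩, rfl⟩ hx'

lemma not_isEndpoint [T2Space G] {e : Fin n} {t : unitInterval} (ht : t ∈ Ioo 0 1) :
    ¬ IsEndpoint (γ e t) := by
  intro h
  have hpre := h (γ e '' Ioo 0 1) ((hγ.isOpen_image_Ioo e 0 1).mem_nhds ⟨t, ht, rfl⟩)
    ⟨⟨_, t, ht, rfl⟩, isPreconnected_Ioo.image _ (hγ.continuous e).continuousOn⟩
  have hdisj : Disjoint (γ e '' Ioo 0 t) (γ e '' Ioo t 1) := by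
    refine disjoint_left.2 ?_
    rintro _ ⟨s, hs, rfl⟩ ⟨s', hs', h⟩
    rw [hγ.injective e h] at hs'
    exact lt_asymm hs.2 hs'.1
  have hsub : γ e '' Ioo 0 1 \ {γ e t} ⊆ γ e '' Ioo 0 t ∪ γ e '' Ioo t 1 := by
    rintro _ ⟨⟨s, hs, rfl⟩, hst⟩
    rcases lt_trichotomy s t with h | rfl | h
    exacts [.inl ⟨s, ⟨hs.1, h⟩, rfl⟩, absurd rfl hst, .inr ⟨s, ⟨h, hs.2⟩, rfl⟩]
  obtain ⟨p, hp0, hp⟩ := exists_between ht.1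
  obtain ⟨q, hq, hq1⟩ := exists_between ht.2
  have hl := hpre.subset_left_of_subset_union (hγ.isOpen_image_Ioo e 0 t)
    (hγ.isOpen_image_Ioo e t 1) hdisj hsub
    ⟨γ e p, ⟨⟨p, ⟨hp0, hp.trans ht.2⟩, rfl⟩, fun h => hp.ne (hγ.injective e h)⟩, p, ⟨hp0, hp⟩, rfl⟩
  have hq' : γ e q ∈ γ e '' Ioo 0 t :=
    hl ⟨⟨q, ⟨ht.1.trans hq, hq1⟩, rfl⟩, fun h => hq.ne' (hγ.injective e h)⟩
  exact hdisj.le_bot ⟨hq', q, ⟨hq, hq1⟩, rfl⟩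

/-- A connected set meets the interior of an arc in the union of at most three intervals: either it
lies in this interior or it contains, with each of its points there, one of the two subarcs leading
to the ends of the arc. -/
lemma preimage_inter_Ioo [T2Space G] {N : Set G} (hN : IsPreconnected N) (e : Fin n) :
    ∃ Q : Fin 3 → Set unitInterval, (∀ i, (Q i).OrdConnected) ∧
      γ e ⁻¹' N ∩ Ioo 0 1 = ⋃ i, Q i := by
  by_cases hsub : N ⊆ γ e '' Ioo 0 1
  · refine ⟨fun _ => γ e ⁻¹' N, fun _ => ?_, ?_⟩
    · refine IsPreconnected.ordConnected ?_
      rw [← (hγ.isEmbedding e).isInducing.isPreconnected_image, image_preimage_eq_of_subset]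
      exacts [hN, hsub.trans (image_subset_range _ _)]
    · rw [iUnion_const]
      refine inter_eq_left.2 fun t ht => ?_
      obtain ⟨s, hs, hst⟩ := hsub ht
      exact hγ.injective e hst ▸ hs
  · refine ⟨![{t | t ∈ Ioo 0 1 ∧ ∀ s, t ≤ s → s < 1 → γ e s ∈ N},
      {t | t ∈ Ioo 0 1 ∧ ∀ s, s ≤ t → 0 < s → γ e s ∈ N}, ∅], ?_, ?_⟩
    · intro i
      fin_cases i
      · refine ⟨fun a ha b hb c hc => ⟨⟨ha.1.1.trans_le hc.1, hc.2.trans_lt hb.1.2⟩, fun s hs => ?_⟩⟩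
        exact ha.2 s (hc.1.trans hs)
      · refine ⟨fun a ha b hb c hc => ⟨⟨ha.1.1.trans_le hc.1, hc.2.trans_lt hb.1.2⟩, fun s hs => ?_⟩⟩
        exact hb.2 s (hs.trans hc.2)
      · exact ordConnected_empty
    · ext t
      simp only [mem_inter_iff, mem_preimage, mem_iUnion, Fin.exists_fin_succ, Fin.exists_fin_zero]
      constructor
      · rintro ⟨htN, ht⟩
        by_contra hcon
        simp only [Fin.isValue, Matrix.cons_val_zero, mem_ofPred_eq, ht, true_and,
          Fin.succ_zero_eq_one, Matrix.cons_val_one, not_or, not_forall] at hcon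
        obtain ⟨⟨q, htq, hq1, hq⟩, ⟨p, hpt, hp0, hp⟩, -⟩ := hcon
        have hpt' : p < t := hpt.lt_of_ne (by rintro rfl; exact hp htN)
        have htq' : t < q := htq.lt_of_ne (by rintro rfl; exact hq htN)
        refine hsub ((hN.subset_left_of_subset_union (hγ.isOpen_image_Ioo e p q)
          (hγ.isClosed_image_Icc e p q).isOpen_compl ?_ ?_
          ⟨_, htN, t, ⟨hpt', htq'⟩, rfl⟩).trans ?_)
        · exact disjoint_compl_right_iff_subset.2 (image_mono Ioo_subset_Icc_self)
        · intro y hy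
          by_cases h : y ∈ γ e '' Icc p q
          · obtain ⟨s, hs, rfl⟩ := h
            refine .inl ⟨s, ⟨hs.1.lt_of_ne ?_, hs.2.lt_of_ne ?_⟩, rfl⟩
            · rintro rfl; exact hp hy
            · rintro rfl; exact hq hy
          · exact .inr h
        · exact image_mono (Ioo_subset_Ioo bot_le le_top)
      · rintro (h | h | h | h)
        · exact ⟨h.2 t le_rfl h.1.2, h.1⟩
        · exact ⟨h.2 t le_rfl h.1.1, h.1⟩
        · exact h.elim
        · exact h.elim

lemma isFiniteUnionOfConnected_diff [T2Space G] {N : Set G} (hN : IsPreconnected N) (e : Fin n)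
    (t : unitInterval) : IsFiniteUnionOfConnected (N \ {γ e t}) := by
  have hpre : N \ {γ e t} = ⋃ e', γ e' '' (γ e' ⁻¹' (N \ {γ e t})) := by
    ext x
    simp only [mem_iUnion]
    constructor
    · intro hx
      obtain ⟨e', s, rfl⟩ := hγ.exists_eq x
      exact ⟨e', s, hx, rfl⟩
    · rintro ⟨e', s, hs, rfl⟩
      exact hs
  rw [hpre]
  refine .iUnion fun e' => .image ?_ (hγ.continuous e')
  obtain ⟨Q, hQ, hQu⟩ := hγ.preimage_inter_Ioo hN e'
  set P := γ e' ⁻¹' (N \ {γ e t})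
  have hP : P = (⋃ i, Q i ∩ Iio t) ∪ (⋃ i, Q i ∩ Ioi t) ∪
      (P ∩ {t} ∪ P ∩ {0} ∪ P ∩ {1}) := by
    have hmem : ∀ s ≠ t, (∃ i, s ∈ Q i) ↔ s ∈ P ∧ s ∈ Ioo 0 1 := by
      intro s hst
      rw [← mem_iUnion, ← hQu]
      refine and_congr_left fun hs => ⟨fun h => ⟨h, fun h' => ?_⟩, fun h => h.1⟩
      exact hst (hγ.eq_of_mem_Ioo hs h').2
    ext s
    simp only [mem_union, mem_iUnion, mem_inter_iff, exists_and_right, mem_singleton_iff, mem_Iio,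
      mem_Ioi]
    constructor
    · intro hs
      by_cases h0 : s = 0
      · exact .inr (.inl (.inr ⟨hs, h0⟩))
      by_cases h1 : s = 1
      · exact .inr (.inr ⟨hs, h1⟩)
      have hs' : s ∈ Ioo 0 1 := ⟨bot_lt_iff_ne_bot.2 h0, lt_top_iff_ne_top.2 h1⟩
      rcases lt_trichotomy s t with h | h | h
      · exact .inl (.inl ⟨(hmem s h.ne).2 ⟨hs, hs'⟩, h⟩)
      · exact .inr (.inl (.inl ⟨hs, h⟩))
      · exact .inl (.inr ⟨(hmem s h.ne').2 ⟨hs, hs'⟩, h⟩)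
    · rintro ((⟨h, hs⟩ | ⟨h, hs⟩) | (⟨h, -⟩ | ⟨h, -⟩) | ⟨h, -⟩)
      · exact ((hmem s hs.ne).1 h).1
      · exact ((hmem s hs.ne').1 h).1
      all_goals exact h
  have hsing : ∀ s, IsFiniteUnionOfConnected (P ∩ {s}) := fun s =>
    .of_isPreconnected (subsingleton_singleton.anti inter_subset_right).isPreconnected
  rw [hP]
  refine .union (.union (.iUnion fun i => ?_) (.iUnion fun i => ?_))
    (((hsing _).union (hsing _)).union (hsing _))
  · exact .of_isPreconnected ((hQ i).inter ordConnected_Iio).isPreconnected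
  · exact .of_isPreconnected ((hQ i).inter ordConnected_Ioi).isPreconnected

lemma not_isBranchPoint [T2Space G] {e : Fin n} {t : unitInterval} (ht : t ∈ Ioo 0 1) :
    ¬ IsBranchPoint (γ e t) := by
  rintro ⟨N, hN, hNc, h3⟩
  have hN' : γ e ⁻¹' N ∈ 𝓝 t := (hγ.continuous e).continuousAt hN
  obtain ⟨a, b, htab, hab⟩ := (mem_nhds_iff_exists_Ioo_subset' ⟨0, ht.1⟩ ⟨1, ht.2⟩).1 hN'
  obtain ⟨p, hap, hpt⟩ := exists_between htab.1
  obtain ⟨q, htq, hqb⟩ := exists_between htab.2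
  have hl : γ e '' Ioo a t ⊆ N \ {γ e t} := by
    rintro _ ⟨s, hs, rfl⟩
    exact ⟨hab ⟨hs.1, hs.2.trans htab.2⟩, fun h => hs.2.ne (hγ.injective e h)⟩
  have hr : γ e '' Ioo t b ⊆ N \ {γ e t} := by
    rintro _ ⟨s, hs, rfl⟩
    exact ⟨hab ⟨htab.1.trans hs.1, hs.2⟩, fun h => hs.1.ne' (hγ.injective e h)⟩
  have hsub : components (N \ {γ e t}) ⊆ {connectedComponentIn (N \ {γ e t}) (γ e p),
      connectedComponentIn (N \ {γ e t}) (γ e q)} := by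
    intro C hC
    have hcl := mem_closure_of_mem_components hNc.isPreconnected (mem_of_mem_nhds hN)
      (hγ.isFiniteUnionOfConnected_diff hNc.isPreconnected e t) hC
    obtain ⟨_, ⟨s, hs, rfl⟩, hsC⟩ := mem_closure_iff.1 hcl _ (hγ.isOpen_image_Ioo e a b)
      ⟨t, htab, rfl⟩
    have hCs := components_subset hC hsC
    obtain ⟨y, hy, rfl⟩ := hC
    rw [connectedComponentIn_eq hsC]
    have hst : s ≠ t := by rintro rfl; exact hCs.2 rfl
    rcases hst.lt_or_gt with h | h
    · exact .inl (connectedComponentIn_eq_of_subset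
        (isPreconnected_Ioo.image _ (hγ.continuous e).continuousOn) hl
        ⟨s, ⟨hs.1, h⟩, rfl⟩ ⟨p, ⟨hap, hpt⟩, rfl⟩)
    · exact .inr (connectedComponentIn_eq_of_subset
        (isPreconnected_Ioo.image _ (hγ.continuous e).continuousOn) hr
        ⟨s, ⟨h, hs.2⟩, rfl⟩ ⟨q, ⟨htq, hqb⟩, rfl⟩)
  have := h3.trans (encard_le_encard hsub)
  have h2 := this.trans (encard_insert_le _ _)
  rw [encard_singleton] at h2
  exact absurd h2 (by norm_num)

end IsArcDecomposition

end

/-! ### Words along the arcs -/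

/-- The heights `s` for which `X × {s}` lies in `U`. -/
def heightsOver {G : Type*} (U : Set (G × unitInterval)) (X : Set G) : Set ℝ :=
  {s | ∃ h : s ∈ Icc (0 : ℝ) 1, ∀ x ∈ X, (x, (⟨s, h⟩ : unitInterval)) ∈ U}

lemma heightsOver_anti {G : Type*} {U : Set (G × unitInterval)} {X Y : Set G} (h : X ⊆ Y) :
    heightsOver U Y ⊆ heightsOver U X :=
  fun _ ⟨hs, hsU⟩ => ⟨hs, fun x hx => hsU x (h hx)⟩

/-- If `K₀` and `K₁` are disjoint compact sets in `G × [0,1]` that contain the bottom and the top,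
then the levels over the points of `G` get heights `w x` such that, for nearby points `x` and `y`,
steps within the complement of `K₀ ∪ K₁` lead from `w x` to `w y`. These are the heights at which
a sufficiently fine colouring of `{x} × [0,1]` into parts off `K₁` and parts off `K₀` changes. -/
theorem exists_heights {G : Type*} [MetricSpace G] {K₀ K₁ : Set (G × unitInterval)}
    (hK₀ : IsCompact K₀) (hK₁ : IsCompact K₁) (hK : Disjoint K₀ K₁)
    (h0 : ∀ x, (x, (0 : unitInterval)) ∈ K₀) (h1 : ∀ x, (x, (1 : unitInterval)) ∈ K₁) :
    ∃ k, Odd k ∧ ∃ r > 0, ∃ w : G → ℕ → ℝ, ∀ x y : G, ∀ X ⊆ Metric.ball x r ∩ Metric.ball y r,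
      Relation.TransGen (fun v v' => ∃ g, IsStep (heightsOver (K₀ ∪ K₁)ᶜ X) k v v' g)
        (w x) (w y) := by
  classical
  obtain ⟨δ, hδ, hthick⟩ := hK.exists_thickenings hK₀ hK₁.isClosed
  have hdist : ∀ p ∈ K₀, ∀ q ∈ K₁, δ ≤ dist p q := by
    intro p hp q hq
    by_contra! h
    exact hthick.le_bot ⟨Metric.mem_thickening_iff.2 ⟨p, hp, by rwa [dist_comm]⟩,
      Metric.self_subset_thickening hδ _ hq⟩
  obtain ⟨n, hn⟩ := exists_nat_one_div_lt hδ
  set N : ℕ := n + 1 with hN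
  have hNpos : (0 : ℝ) < N := by positivity
  have hN1 : 1 / (N : ℝ) < δ := by rw [hN]; push_cast; exact hn
  let cell : ℕ → Set ℝ := fun j => Icc ((j : ℝ) / N) ((j + 1 : ℕ) / N)
  have hcell : ∀ {j s s'}, s ∈ cell j → s' ∈ cell j → |s - s'| < δ := by
    rintro j s s' ⟨h1, h2⟩ ⟨h3, h4⟩
    have : ((j + 1 : ℕ) : ℝ) / N = j / N + 1 / N := by push_cast; ring
    rw [abs_lt]; constructor <;> linarith
  have hcell01 : ∀ j ≤ n, cell j ⊆ Icc 0 1 := by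
    rintro j hj s ⟨h1, h2⟩
    refine ⟨le_trans (by positivity) h1, h2.trans ?_⟩
    rw [div_le_one hNpos]
    exact_mod_cast Nat.succ_le_succ hj
  let c : G → ℕ → Bool := fun x j => decide (∃ y ∈ Metric.ball x (δ / 2), ∃ s : unitInterval,
    (s : ℝ) ∈ cell j ∧ (y, s) ∈ K₁)
  have hc0 : ∀ x, c x 0 = false := by
    intro x
    refine decide_eq_false ?_
    rintro ⟨y, -, s, hs, hsK⟩
    have hd := hdist _ (h0 y) _ hsK
    rw [Prod.dist_eq, dist_self, max_eq_right dist_nonneg, Subtype.dist_eq, Real.dist_eq] at hd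
    exact absurd (hcell (j := 0) (by simp [cell]) hs) (not_lt.2 hd)
  have hcn : ∀ x, c x n = true := by
    intro x
    refine decide_eq_true ⟨x, Metric.mem_ball_self (by positivity), 1, ?_, h1 x⟩
    refine ⟨?_, ?_⟩
    · rw [div_le_iff₀ hNpos]; simp [hN]
    · rw [le_div_iff₀ hNpos]; simp [hN]
  let L : Set (G × unitInterval) → Set G → Set ℝ := fun K X => heightsOver Kᶜ X
  have hadm : ∀ x, ∀ X ⊆ Metric.ball x (δ / 2), Admissible (L K₀ X) (L K₁ X) N n (c x) := by
    intro x X hX j hj s hs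
    by_cases h : c x j = true
    · rw [if_pos h]
      refine ⟨hcell01 j hj hs, fun y hy hyK => ?_⟩
      obtain ⟨y', hy', s', hs', hsK⟩ := of_decide_eq_true h
      have hd := hdist _ hyK _ hsK
      have hyy : dist y y' < δ := by
        have h1 := Metric.mem_ball.1 (hX hy)
        have h2 := Metric.mem_ball'.1 hy'
        linarith [dist_triangle y x y']
      rw [Prod.dist_eq, Subtype.dist_eq, Real.dist_eq] at hd
      exact absurd (max_lt hyy (hcell hs hs')) (not_lt.2 hd)
    · rw [if_neg h]
      refine ⟨hcell01 j hj hs, fun y hy hyK => ?_⟩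
      exact h (decide_eq_true ⟨y, hX hy, _, hs, hyK⟩)
  refine ⟨2 * n + 1, ⟨n, rfl⟩, δ / 2, by positivity,
    fun x => heights (padWord (2 * n + 1) (colourWord N n (c x))), fun x y X hX => ?_⟩
  have hx := hadm x X fun z hz => (hX hz).1
  have hy := hadm y X fun z hz => (hX hz).2
  have hnk : n ≤ 2 * n + 1 := by omega
  have hodd := (odd_length_colourWord N n (c x)).2 (by rw [hc0, hcn]; simp)
  have hne : colourWord N n (c x) ≠ [] := by intro h; rw [h] at hodd; simp at hodd
  have hsub : L K₀ X ∩ L K₁ X ⊆ heightsOver (K₀ ∪ K₁)ᶜ X := by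
    rintro s ⟨⟨hs, hs0⟩, ⟨_, hs1⟩⟩
    exact ⟨hs, fun z hz h => h.elim (hs0 z hz) (hs1 z hz)⟩
  have := (WordEquiv.colourWord hx hy (hc0 x) (hcn x) (hc0 y) (hcn y) ⟨n, rfl⟩
    hnk).transGen_isStep fun z hz => hx.mem_of_mem_colourWord (mem_of_mem_padWord hne hz)
  rw [length_padWord ((length_colourWord_le N n (c x)).trans hnk)] at this
  exact Relation.TransGen.mono (fun v v' ⟨g, hg⟩ => ⟨g, hg.mono hsub⟩) _ _ this

/-- A sequence of steps along the path `γ` on `[0,1]`, from the heights `w` to the heights `w'`: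
the step number `l` takes place over the parameter interval `[t l, t (l + 1)]`. -/
structure StepChain {G : Type*} (U : Set (G × unitInterval)) (γ : ℝ → G) (k : ℕ)
    (w w' : ℕ → ℝ) where
  /-- the number of steps -/
  m : ℕ
  /-- the parameters at which the steps begin and end -/
  t : ℕ → ℝ
  /-- the heights between the steps -/
  W : ℕ → ℕ → ℝ
  /-- the interrupted level of each step -/
  g : ℕ → Option ℕ
  t_zero : t 0 = 0
  t_last : t m = 1
  W_zero : W 0 = w
  W_last : W m = w'
  lt : ∀ l < m, t l < t (l + 1)
  isStep : ∀ l < m, IsStep (heightsOver U (γ '' Icc (t l) (t (l + 1)))) k (W l) (W (l + 1)) (g l)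

lemma exists_seq_of_transGen {α : Type*} {R : α → α → Prop} {a b : α}
    (h : Relation.TransGen R a b) :
    ∃ (m : ℕ) (s : ℕ → α), s 0 = a ∧ s m = b ∧ ∀ l < m, R (s l) (s (l + 1)) := by
  induction h with
  | @single b h => exact ⟨1, fun l => if l = 0 then a else b, by simp, by simp, by simpa using h⟩
  | @tail b c _ h ih =>
    obtain ⟨m, s, h0, hm, hs⟩ := ih
    refine ⟨m + 1, fun l => if l ≤ m then s l else c, by simpa using h0, by simp, fun l hl => ?_⟩
    rcases (Nat.lt_succ_iff.1 hl).lt_or_eq with h' | rfl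
    · simpa [h'.le, Nat.succ_le_of_lt h'] using hs l h'
    · simpa [hm] using h

section Chains

variable {G : Type*} {U : Set (G × unitInterval)} {γ : ℝ → G} {k : ℕ}

/-- One step along `γ` from parameter `p.1` and heights `p.2` to parameter `q.1` and heights
`q.2`. -/
def PathStep (U : Set (G × unitInterval)) (γ : ℝ → G) (k : ℕ) (p q : ℝ × (ℕ → ℝ)) : Prop :=
  p.1 < q.1 ∧ ∃ g, IsStep (heightsOver U (γ '' Icc p.1 q.1)) k p.2 q.2 g

lemma nonempty_stepChain {w w' : ℕ → ℝ}
    (h : Relation.TransGen (PathStep U γ k) (0, w) (1, w')) : Nonempty (StepChain U γ k w w') := by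
  obtain ⟨m, s, h0, hm, hs⟩ := exists_seq_of_transGen h
  choose! g hg using fun l hl => (hs l hl).2
  exact ⟨⟨m, fun l => (s l).1, fun l => (s l).2, g, by rw [h0], by rw [hm], by rw [h0], by rw [hm],
    fun l hl => (hs l hl).1, hg⟩⟩

/-- Finitely many steps over a set `X` may be carried out one after the other along any piece of
path in `X`. -/
lemma transGen_pathStep {X : Set G} {w w' : ℕ → ℝ}
    (h : Relation.TransGen (fun v v' => ∃ g, IsStep (heightsOver U X) k v v' g) w w') :
    ∀ p q : ℝ, p < q → γ '' Icc p q ⊆ X →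
      Relation.TransGen (PathStep U γ k) (p, w) (q, w') := by
  induction h with
  | single h =>
    intro p q hpq hX
    obtain ⟨g, hg⟩ := h
    exact .single ⟨hpq, g, hg.mono (heightsOver_anti hX)⟩
  | tail _ h ih =>
    intro p q hpq hX
    obtain ⟨z, hpz, hzq⟩ := exists_between hpq
    obtain ⟨g, hg⟩ := h
    refine (ih p z hpz ((image_mono (Icc_subset_Icc_right hzq.le)).trans hX)).tail
      ⟨hzq, g, hg.mono (heightsOver_anti ?_)⟩
    exact (image_mono (Icc_subset_Icc_left hpz.le)).trans hX

lemma nonempty_stepChain_of_local {G : Type*} [MetricSpace G] {U : Set (G × unitInterval)}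
    {γ : ℝ → G} (hγ : ContinuousOn γ (Icc 0 1)) {r : ℝ} (hr : 0 < r) {w : G → ℕ → ℝ}
    (hw : ∀ x y : G, ∀ X ⊆ Metric.ball x r ∩ Metric.ball y r,
      Relation.TransGen (fun v v' => ∃ g, IsStep (heightsOver U X) k v v' g) (w x) (w y)) :
    Nonempty (StepChain U γ k (w (γ 0)) (w (γ 1))) := by
  obtain ⟨η, hη, hunif⟩ := Metric.uniformContinuousOn_iff.1
    (isCompact_Icc.uniformContinuousOn_of_continuous hγ) r hr
  obtain ⟨n, hn⟩ := exists_nat_one_div_lt hη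
  have hpos : (0 : ℝ) < n + 1 := by positivity
  have hstep : ∀ l : ℕ, l < n + 1 → Relation.TransGen (PathStep U γ k)
      ((l : ℝ) / (n + 1), w (γ (l / (n + 1))))
      ((l + 1 : ℕ) / (n + 1), w (γ ((l + 1 : ℕ) / (n + 1)))) := by
    intro l hl
    have hadd : ((l + 1 : ℕ) : ℝ) / (n + 1) = l / (n + 1) + 1 / (n + 1) := by push_cast; ring
    have hlt : (l : ℝ) / (n + 1) < (l + 1 : ℕ) / (n + 1) := by
      rw [hadd]; linarith [show 0 < 1 / ((n : ℝ) + 1) by positivity]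
    have hl0 : 0 ≤ (l : ℝ) / (n + 1) := by positivity
    have hl1 : ((l + 1 : ℕ) : ℝ) / (n + 1) ≤ 1 := by
      rw [div_le_one hpos]; exact_mod_cast hl
    refine transGen_pathStep (hw _ _ _ ?_) _ _ hlt Subset.rfl
    rintro _ ⟨s, hs, rfl⟩
    have hs01 : s ∈ Icc (0 : ℝ) 1 := ⟨hl0.trans hs.1, hs.2.trans hl1⟩
    constructor <;> refine Metric.mem_ball.2 (hunif s hs01 _ ⟨?_, ?_⟩ ?_)
    · exact hl0
    · exact hlt.le.trans hl1
    · rw [Real.dist_eq, abs_lt]; constructor <;> linarith [hs.1, hs.2]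
    · exact hl0.trans hlt.le
    · exact hl1
    · rw [Real.dist_eq, abs_lt]; constructor <;> linarith [hs.1, hs.2]
  have main : ∀ l : ℕ, l < n + 1 → Relation.TransGen (PathStep U γ k) (0, w (γ 0))
      ((l + 1 : ℕ) / (n + 1), w (γ ((l + 1 : ℕ) / (n + 1)))) := by
    intro l
    induction l with
    | zero => intro hl; simpa using hstep 0 hl
    | succ l ih => exact fun hl => (ih (by omega)).trans (hstep (l + 1) hl)
  refine nonempty_stepChain ?_
  have := main n (by omega)
  rwa [show ((n + 1 : ℕ) : ℝ) / (n + 1) = 1 by push_cast; exact div_self hpos.ne'] at this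

end Chains

/-! ### Gluing along the arcs -/

/-- The function that is `0` up to `a`, `1` from `b` on, and linear between `a` and `b`. -/
noncomputable def ramp (a b s : ℝ) : ℝ := max 0 (min 1 ((s - a) / (b - a)))

lemma continuous_ramp (a b : ℝ) : Continuous (ramp a b) := by
  unfold ramp; fun_prop

lemma ramp_of_le {a b s : ℝ} (hab : a < b) (h : s ≤ a) : ramp a b s = 0 := by
  have : (s - a) / (b - a) ≤ 0 := div_nonpos_of_nonpos_of_nonneg (by linarith) (by linarith)
  exact max_eq_left ((min_le_right _ _).trans this)

lemma ramp_of_ge {a b s : ℝ} (hab : a < b) (h : b ≤ s) : ramp a b s = 1 := by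
  have : 1 ≤ (s - a) / (b - a) := by rw [le_div_iff₀ (by linarith)]; linarith
  rw [ramp, min_eq_left this]; simp

lemma ramp_mem (a b s : ℝ) : ramp a b s ∈ Icc (0 : ℝ) 1 :=
  ⟨le_max_left _ _, max_le zero_le_one (min_le_left _ _)⟩

namespace StepChain

variable {G : Type*} {U : Set (G × unitInterval)} {γ : ℝ → G} {k : ℕ} {w w' : ℕ → ℝ}
  (c : StepChain U γ k w w')

/-- The point of the parameter interval of step `l` at which the step starts to move. -/
noncomputable def a (l : ℕ) : ℝ := c.t l + (c.t (l + 1) - c.t l) / 3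

/-- The point of the parameter interval of step `l` at which the step stops to move. -/
noncomputable def b (l : ℕ) : ℝ := c.t l + 2 * (c.t (l + 1) - c.t l) / 3

lemma t_lt_a {l : ℕ} (hl : l < c.m) : c.t l < c.a l := by
  have := c.lt l hl; unfold a; linarith

lemma a_lt_b {l : ℕ} (hl : l < c.m) : c.a l < c.b l := by
  have := c.lt l hl; unfold a b; linarith

lemma b_lt_t {l : ℕ} (hl : l < c.m) : c.b l < c.t (l + 1) := by
  have := c.lt l hl; unfold b; linarith

lemma t_mono {l l' : ℕ} (h : l ≤ l') (hl' : l' ≤ c.m) : c.t l ≤ c.t l' := by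
  induction l', h using Nat.le_induction with
  | base => exact le_rfl
  | succ j _ ih => exact (ih (by omega)).trans (c.lt j hl').le

lemma t_mem {l : ℕ} (hl : l ≤ c.m) : c.t l ∈ Icc (0 : ℝ) 1 :=
  ⟨c.t_zero ▸ c.t_mono (Nat.zero_le l) hl, c.t_last ▸ c.t_mono hl le_rfl⟩

lemma m_pos : 0 < c.m := by
  by_contra h
  have h1 := c.t_last
  rw [show c.m = 0 by omega, c.t_zero] at h1
  exact zero_ne_one h1

lemma Icc_subset_Ioo {l : ℕ} (hl : l < c.m) : Icc (c.a l) (c.b l) ⊆ Ioo 0 1 := fun _ hs =>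
  ⟨(c.t_mem hl.le).1.trans_lt ((c.t_lt_a hl).trans_le hs.1),
    hs.2.trans_lt ((c.b_lt_t hl).trans_le (c.t_mem hl).2)⟩

lemma eq_of_mem_Icc {l l' : ℕ} (hl : l < c.m) (hl' : l' < c.m) {s : ℝ}
    (h : s ∈ Icc (c.a l) (c.b l)) (h' : s ∈ Icc (c.t l') (c.t (l' + 1))) : l = l' := by
  have h1 := c.t_lt_a hl
  have h2 := c.b_lt_t hl
  rcases lt_trichotomy l l' with hh | hh | hh
  · have := c.t_mono (Nat.succ_le_of_lt hh) hl'.le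
    linarith [h.2, h'.1]
  · exact hh
  · have := c.t_mono (Nat.succ_le_of_lt hh) hl.le
    linarith [h.1, h'.2]

lemma exists_mem_Icc {s : ℝ} (hs : s ∈ Icc (0 : ℝ) 1) :
    ∃ l < c.m, s ∈ Icc (c.t l) (c.t (l + 1)) := by
  have : ∀ j, j < c.m → s ≤ c.t (j + 1) → ∃ l < c.m, s ∈ Icc (c.t l) (c.t (l + 1)) := by
    intro j
    induction j with
    | zero => exact fun hj h => ⟨0, hj, c.t_zero.symm ▸ hs.1, h⟩
    | succ j ih =>
      intro hj h
      rcases le_total s (c.t (j + 1)) with h' | h'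
      · exact ih (by omega) h'
      · exact ⟨j + 1, hj, h', h⟩
  have hm := c.m_pos
  refine this (c.m - 1) (by omega) ?_
  rw [Nat.sub_add_cancel hm, c.t_last]
  exact hs.2

/-- The height of level `i` as a function of the parameter. It is constant on the outer thirds of
the parameter interval of each step, and linear on the middle third. -/
noncomputable def height (i : ℕ) (s : ℝ) : ℝ :=
  c.W 0 i + ∑ l ∈ Finset.range c.m, ramp (c.a l) (c.b l) s * (c.W (l + 1) i - c.W l i)

lemma continuous_height (i : ℕ) : Continuous (c.height i) :=
  continuous_const.add (continuous_finsetSum _ fun _ _ =>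
    (continuous_ramp _ _).mul continuous_const)

lemma height_eq {l : ℕ} (hl : l < c.m) {s : ℝ} (hs : s ∈ Icc (c.t l) (c.t (l + 1))) (i : ℕ) :
    c.height i s = c.W l i + ramp (c.a l) (c.b l) s * (c.W (l + 1) i - c.W l i) := by
  obtain ⟨q, hq⟩ : ∃ q, c.m = l + 1 + q := ⟨c.m - (l + 1), by omega⟩
  have h1 : ∑ j ∈ Finset.range l, ramp (c.a j) (c.b j) s * (c.W (j + 1) i - c.W j i) =
      c.W l i - c.W 0 i := by
    rw [← Finset.sum_range_sub (fun j => c.W j i)]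
    refine Finset.sum_congr rfl fun j hj => ?_
    have hj' := Finset.mem_range.1 hj
    have hjm : j < c.m := by omega
    rw [ramp_of_ge (c.a_lt_b hjm)
      ((c.b_lt_t hjm).le.trans ((c.t_mono (Nat.succ_le_of_lt hj') hl.le).trans hs.1)), one_mul]
  have h2 : ∑ j ∈ Finset.range q, ramp (c.a (l + 1 + j)) (c.b (l + 1 + j)) s *
      (c.W (l + 1 + j + 1) i - c.W (l + 1 + j) i) = 0 := by
    refine Finset.sum_eq_zero fun j hj => ?_
    have hj' := Finset.mem_range.1 hj
    have hjm : l + 1 + j < c.m := by omega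
    rw [ramp_of_le (c.a_lt_b hjm) ((hs.2.trans
      (c.t_mono (Nat.le_add_right _ _) hjm.le)).trans (c.t_lt_a hjm).le), zero_mul]
  rw [height, hq, Finset.sum_range_add, Finset.sum_range_succ, h1, h2]
  ring

lemma height_zero (i : ℕ) : c.height i 0 = w i := by
  have h := c.t_zero
  rw [c.height_eq c.m_pos ⟨h.le, h ▸ c.t_mono (Nat.zero_le _) c.m_pos⟩, c.W_zero,
    ramp_of_le (c.a_lt_b c.m_pos) (h ▸ (c.t_lt_a c.m_pos).le)]
  ring

lemma height_one (i : ℕ) : c.height i 1 = w' i := by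
  have hm := c.m_pos
  have hlt : c.m - 1 < c.m := by omega
  have e : c.m - 1 + 1 = c.m := by omega
  have h := c.t_last
  rw [c.height_eq hlt (by rw [e, h]; exact ⟨(c.t_mem hlt.le).2, le_rfl⟩),
    ramp_of_ge (c.a_lt_b hlt) (by have := c.b_lt_t hlt; rw [e, h] at this; exact this.le), e,
    c.W_last]
  ring

/-- The heights at the ends of an interruption agree. -/
lemma height_eq_of_gap {l i : ℕ} (hl : l < c.m) (hg : c.g l = some i) {s : ℝ}
    (hs : s = c.a l ∨ s = c.b l) : c.height i s = c.height (i + 1) s := by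
  obtain ⟨-, h1, h2⟩ := (c.isStep l hl).2.2 i hg
  have h3 := c.t_lt_a hl
  have h4 := c.a_lt_b hl
  have h5 := c.b_lt_t hl
  have hmem : s ∈ Icc (c.t l) (c.t (l + 1)) := by
    rcases hs with rfl | rfl <;> constructor <;> linarith
  rw [c.height_eq hl hmem, c.height_eq hl hmem, h1, h2]

/-- Outside the interruptions the heights are admissible. -/
lemma exists_height_mem {i : ℕ} (hi : i < k) {s : ℝ} (hs : s ∈ Icc (0 : ℝ) 1)
    (hgap : ∀ l < c.m, ∀ j, c.g l = some j → (j = i ∨ j + 1 = i) → s ∉ Ioo (c.a l) (c.b l)) :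
    ∃ h : unitInterval, (h : ℝ) = c.height i s ∧ (γ s, h) ∈ U := by
  obtain ⟨l, hl, hsl⟩ := c.exists_mem_Icc hs
  suffices H : c.height i s ∈ heightsOver U (γ '' Icc (c.t l) (c.t (l + 1))) by
    obtain ⟨h01, h⟩ := H
    exact ⟨⟨_, h01⟩, rfl, h _ ⟨s, hsl, rfl⟩⟩
  rw [c.height_eq hl hsl]
  obtain ⟨h1, h2, -⟩ := c.isStep l hl
  by_cases hg : ∃ j, c.g l = some j ∧ (j = i ∨ j + 1 = i)
  · obtain ⟨j, hj, hji⟩ := hg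
    rcases le_or_gt s (c.a l) with h | h
    · rw [ramp_of_le (c.a_lt_b hl) h]
      simpa using (h1 i hi).1
    · have hb : c.b l ≤ s := by
        by_contra! h'
        exact hgap l hl j hj hji ⟨h, h'⟩
      rw [ramp_of_ge (c.a_lt_b hl) hb]
      simpa using (h1 i hi).2
  · push Not at hg
    refine h2 i hi hg ?_
    rw [← segment_eq_uIcc, segment_eq_image']
    exact ⟨_, ramp_mem (c.a l) (c.b l) s, by simp⟩

end StepChain

/-- A path parametrized by `[0,1]`, extended to the real line so that real arithmetic applies to its
parameters. -/
noncomputable def extend {G : Type*} (γ : unitInterval → G) : ℝ → G :=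
  IccExtend (zero_le_one' ℝ) γ

section Extend

variable {G : Type*}

lemma extend_apply (γ : unitInterval → G) {s : ℝ} (hs : s ∈ Icc (0 : ℝ) 1) :
    extend γ s = γ ⟨s, hs⟩ := IccExtend_of_mem _ _ hs

lemma extend_image_Ioo (γ : unitInterval → G) {a b : ℝ} (ha : a ∈ Icc (0 : ℝ) 1)
    (hb : b ∈ Icc (0 : ℝ) 1) : extend γ '' Ioo a b = γ '' Ioo ⟨a, ha⟩ ⟨b, hb⟩ := by
  ext x
  constructor
  · rintro ⟨s, hs, rfl⟩
    have hs' : s ∈ Icc (0 : ℝ) 1 := ⟨ha.1.trans hs.1.le, hs.2.le.trans hb.2⟩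
    exact ⟨⟨s, hs'⟩, hs, (extend_apply γ hs').symm⟩
  · rintro ⟨⟨s, hs'⟩, hs, rfl⟩
    exact ⟨s, hs, extend_apply γ hs'⟩

lemma extend_image_Icc (γ : unitInterval → G) {a b : ℝ} (ha : a ∈ Icc (0 : ℝ) 1)
    (hb : b ∈ Icc (0 : ℝ) 1) : extend γ '' Icc a b = γ '' Icc ⟨a, ha⟩ ⟨b, hb⟩ := by
  ext x
  constructor
  · rintro ⟨s, hs, rfl⟩
    have hs' : s ∈ Icc (0 : ℝ) 1 := ⟨ha.1.trans hs.1, hs.2.trans hb.2⟩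
    exact ⟨⟨s, hs'⟩, hs, (extend_apply γ hs').symm⟩
  · rintro ⟨⟨s, hs'⟩, hs, rfl⟩
    exact ⟨s, hs, extend_apply γ hs'⟩

end Extend

namespace IsArcDecomposition

variable {G : Type*} [TopologicalSpace G] {n : ℕ} {γ : Fin n → unitInterval → G}
  (hγ : IsArcDecomposition γ)

include hγ

lemma continuous_extend (e : Fin n) : Continuous (extend (γ e)) := (hγ.continuous e).Icc_extend'

lemma exists_extend_eq (x : G) : ∃ e, ∃ s ∈ Icc (0 : ℝ) 1, extend (γ e) s = x := by
  obtain ⟨e, t, rfl⟩ := hγ.exists_eq x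
  exact ⟨e, t, t.2, IccExtend_val _ _ t⟩

lemma eq_of_extend_eq {e e' : Fin n} {s t : ℝ} (hs : s ∈ Ioo (0 : ℝ) 1) (ht : t ∈ Icc (0 : ℝ) 1)
    (h : extend (γ e) s = extend (γ e') t) : e = e' ∧ s = t := by
  rw [extend_apply _ (Ioo_subset_Icc_self hs), extend_apply _ ht] at h
  obtain ⟨h1, h2⟩ := hγ.eq_of_mem_Ioo (s := ⟨s, Ioo_subset_Icc_self hs⟩) (t := ⟨t, ht⟩) hs h
  exact ⟨h1, congrArg Subtype.val h2⟩

/-- Functions on the arcs that agree at the ends define a continuous function on the graph. -/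
lemma exists_continuous_glue [T2Space G] {F : Fin n → ℝ → ℝ} (hF : ∀ e, Continuous (F e))
    {w : G → ℝ} (h0 : ∀ e, F e 0 = w (extend (γ e) 0)) (h1 : ∀ e, F e 1 = w (extend (γ e) 1)) :
    ∃ f : G → ℝ, Continuous f ∧ ∀ e, ∀ s ∈ Icc (0 : ℝ) 1, f (extend (γ e) s) = F e s := by
  choose ε σ hσ hεσ using hγ.exists_extend_eq
  have hf : ∀ e, ∀ s ∈ Icc (0 : ℝ) 1,
      F (ε (extend (γ e) s)) (σ (extend (γ e) s)) = F e s := by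
    intro e s hs
    have h := hεσ (extend (γ e) s)
    have hσs := hσ (extend (γ e) s)
    set e' := ε (extend (γ e) s)
    set s' := σ (extend (γ e) s)
    -- an end of an arc is an end of every other arc through this point
    by_cases hs' : s ∈ Ioo (0 : ℝ) 1
    · obtain ⟨h1, h2⟩ := hγ.eq_of_extend_eq hs' hσs h.symm
      rw [← h1, ← h2]
    by_cases hσ' : s' ∈ Ioo (0 : ℝ) 1
    · obtain ⟨h1, h2⟩ := hγ.eq_of_extend_eq hσ' hs h
      rw [h1, h2]
    have hend : ∀ e, ∀ t ∈ Icc (0 : ℝ) 1, t ∉ Ioo (0 : ℝ) 1 → F e t = w (extend (γ e) t) := by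
      intro e t ht ht'
      rcases ht.1.eq_or_lt with rfl | h
      · exact h0 e
      rcases ht.2.eq_or_lt with rfl | h'
      · exact h1 e
      exact absurd ⟨h, h'⟩ ht'
    rw [hend e s hs hs', hend e' s' hσs hσ', h]
  refine ⟨fun x => F (ε x) (σ x), ?_, hf⟩
  refine (locallyFinite_of_finite fun e => range (γ e)).continuous hγ.iUnion_range
    (fun e => (isCompact_range (hγ.continuous e)).isClosed) fun e => ?_
  rw [continuousOn_iff_continuous_domRestrict,
    ← (hγ.isEmbedding e).toHomeomorph.comp_continuous_iff']
  have : (range (γ e)).domRestrict (fun x => F (ε x) (σ x)) ∘ (hγ.isEmbedding e).toHomeomorph =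
      fun t : unitInterval => F e t := by
    funext t
    have := hf e t t.2
    rwa [show extend (γ e) t = γ e t from IccExtend_val _ _ t] at this
  rw [this]
  exact (hF e).comp continuous_subtype_val

/-- Chains of steps along all the arcs, with common heights at the ends of the arcs, yield a
stairwell structure. -/
theorem exists_hasStairwellStructure [T2Space G] [Nonempty G] {U : Set (G × unitInterval)} {k : ℕ}
    {w : G → ℕ → ℝ}
    (c : ∀ e, StepChain U (extend (γ e)) k (w (extend (γ e) 0)) (w (extend (γ e) 1))) :
    ∃ S ⊆ U, HasStairwellStructure S k := by
  choose f hf hfF using fun i : ℕ => hγ.exists_continuous_glue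
    (fun e => (c e).continuous_height i) (w := fun x => w x i)
    (fun e => (c e).height_zero i) (fun e => (c e).height_one i)
  let ι : Type := {p : (Σ e, Fin (c e).m) × Fin k // (c p.1.1).g p.1.2 = some p.2.val}
  let a : ι → ℝ := fun p => (c p.1.1.1).a p.1.1.2
  let b : ι → ℝ := fun p => (c p.1.1.1).b p.1.1.2
  let γ' : ι → ℝ → G := fun p => extend (γ p.1.1.1)
  let C : ι → Set G := fun p => γ' p '' Ioo (a p) (b p)
  let lev : ι → ℕ := fun p => p.1.2
  have hm : ∀ p : ι, p.1.1.2.val < (c p.1.1.1).m := fun p => p.1.1.2.2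
  have hab : ∀ p, a p < b p := fun p => (c p.1.1.1).a_lt_b (hm p)
  have hIcc : ∀ p, Icc (a p) (b p) ⊆ Ioo 0 1 := fun p => (c p.1.1.1).Icc_subset_Ioo (hm p)
  have ha : ∀ p, a p ∈ Icc (0 : ℝ) 1 := fun p =>
    Ioo_subset_Icc_self (hIcc p (left_mem_Icc.2 (hab p).le))
  have hb : ∀ p, b p ∈ Icc (0 : ℝ) 1 := fun p =>
    Ioo_subset_Icc_self (hIcc p (right_mem_Icc.2 (hab p).le))
  have hC : ∀ p, C p = γ p.1.1.1 '' Ioo ⟨a p, ha p⟩ ⟨b p, hb p⟩ := fun p =>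
    extend_image_Ioo _ (ha p) (hb p)
  have hcl : ∀ p, closure (C p) ⊆ γ' p '' Icc (a p) (b p) := by
    intro p
    rw [hC, extend_image_Icc _ (ha p) (hb p)]
    exact hγ.closure_image_Ioo_subset _ _ _
  have hfr : ∀ p, frontier (C p) ⊆ {γ' p (a p), γ' p (b p)} := by
    intro p
    rw [hC, show γ' p (a p) = _ from extend_apply _ (ha p),
      show γ' p (b p) = _ from extend_apply _ (hb p)]
    exact hγ.frontier_image_Ioo_subset _ _ _
  -- on each arc, the gaps of a level are the interruptions of the chain
  have hbase : ∀ (i : ℕ) (e : Fin n) (s : ℝ), s ∈ Icc (0 : ℝ) 1 →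
      (extend (γ e) s ∈ levelBase lev C i ↔ ∀ l < (c e).m, ∀ j, (c e).g l = some j →
        (j = i ∨ j + 1 = i) → s ∉ Ioo ((c e).a l) ((c e).b l)) := by
    intro i e s hs
    simp only [levelBase, mem_compl_iff, mem_iUnion, mem_ofPred_eq, exists_prop, not_exists,
      not_and]
    constructor
    · intro h l hl j hj hji hsl
      have hjk : j < k := Nat.lt_of_succ_lt (((c e).isStep l hl).2.2 j hj).1
      exact h ⟨(⟨e, l, hl⟩, ⟨j, hjk⟩), hj⟩ hji ⟨s, hsl, rfl⟩
    · rintro h ⟨⟨⟨e', l⟩, j⟩, hj⟩ hji ⟨s', hs', hss⟩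
      obtain ⟨rfl, rfl⟩ := hγ.eq_of_extend_eq (hIcc _ (Ioo_subset_Icc_self hs')) hs hss
      exact h l l.2 j hj hji hs'
  refine exists_hasStairwellStructure_of_gaps (lev := lev) (C := C) (f := f) (fun p => ?_)
    (fun p => ?_) (fun p q hpq => ?_) (fun p => ?_) (fun p x hx => ?_) (fun p => ?_)
    (fun i _ => hf i) (fun p x hx => ?_) (fun i _ => ?_) (fun i _ => ?_) (fun i hi x hx => ?_)
  · rw [hC]; exact hγ.isOpen_image_Ioo _ _ _
  · exact isPreconnected_Ioo.image _ (hγ.continuous_extend _).continuousOn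
  · refine disjoint_left.2 fun x hxp hxq => hpq ?_
    obtain ⟨s, hs, rfl⟩ := hcl p hxp
    obtain ⟨s', hs', hss⟩ := hcl q hxq
    obtain ⟨h1, rfl⟩ := hγ.eq_of_extend_eq (hIcc q hs') (Ioo_subset_Icc_self (hIcc p hs)) hss
    obtain ⟨⟨⟨e, l⟩, j⟩, hj⟩ := p
    obtain ⟨⟨⟨e', l'⟩, j'⟩, hj'⟩ := q
    obtain rfl : e' = e := h1
    have h2 := (c e').eq_of_mem_Icc l'.2 l.2 hs'
      ⟨((c e').t_lt_a l.2).le.trans hs.1, hs.2.trans ((c e').b_lt_t l.2).le⟩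
    obtain rfl : l' = l := Fin.ext h2
    have h3 : some j.val = some j'.val := hj.symm.trans hj'
    obtain rfl : j = j' := Fin.ext (Option.some.inj h3)
    rfl
  · exact (toFinite _).subset (hfr p)
  · have key : ∀ s (hs : s ∈ Ioo (0 : ℝ) 1), ¬ IsBranchPoint (γ' p s) ∧ ¬ IsEndpoint (γ' p s) := by
      intro s hs
      rw [show γ' p s = _ from extend_apply _ (Ioo_subset_Icc_self hs)]
      exact ⟨hγ.not_isBranchPoint hs, hγ.not_isEndpoint hs⟩
    rcases hfr p hx with rfl | rfl
    exacts [key _ (hIcc p (left_mem_Icc.2 (hab p).le)), key _ (hIcc p (right_mem_Icc.2 (hab p).le))]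
  · exact (((c p.1.1.1).isStep _ (hm p)).2.2 _ p.2).1
  · rcases hfr p hx with rfl | rfl
    · rw [hfF _ _ _ (ha p), hfF _ _ _ (ha p)]
      exact (c p.1.1.1).height_eq_of_gap (hm p) p.2 (.inl rfl)
    · rw [hfF _ _ _ (hb p), hfF _ _ _ (hb p)]
      exact (c p.1.1.1).height_eq_of_gap (hm p) p.2 (.inr rfl)
  · -- the base is the union of the outer thirds, and of those middle thirds that are not gaps
    let thirds : ∀ e, Fin (c e).m → Set (Set ℝ) := fun e l =>
      {Icc ((c e).t l) ((c e).a l), Icc ((c e).b l) ((c e).t (l + 1)),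
        Icc ((c e).a l) ((c e).b l)}
    let 𝒮 : Set (Set G) := {A | A ⊆ levelBase lev C i ∧
      ∃ e l, ∃ I ∈ thirds e l, A = extend (γ e) '' I}
    have hint : ∀ e l, ∀ I ∈ thirds e l, I ⊆ Icc 0 1 ∧ ∃ p q, p < q ∧ I = Icc p q := by
      rintro e l I hI
      have h1 := (c e).t_lt_a l.2
      have h2 := (c e).a_lt_b l.2
      have h3 := (c e).b_lt_t l.2
      have h4 := ((c e).t_mem l.2.le).1
      have h5 := ((c e).t_mem l.2).2
      rcases hI with rfl | rfl | rfl
      · exact ⟨Icc_subset_Icc h4 (by linarith), _, _, h1, rfl⟩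
      · exact ⟨Icc_subset_Icc (by linarith) h5, _, _, h3, rfl⟩
      · exact ⟨Icc_subset_Icc (by linarith) (by linarith), _, _, h2, rfl⟩
    have hfin : 𝒮.Finite := by
      have : (⋃ e, ⋃ l, image (extend (γ e)) '' thirds e l).Finite :=
        finite_iUnion fun e => finite_iUnion fun l => (toFinite _).image _
      refine this.subset ?_
      rintro A ⟨-, e, l, I, hI, rfl⟩
      exact mem_iUnion.2 ⟨e, mem_iUnion.2 ⟨l, I, hI, rfl⟩⟩
    have hpre : ∀ A ∈ 𝒮, IsPreconnected A := by
      rintro A ⟨-, e, l, I, hI, rfl⟩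
      obtain ⟨-, p, q, -, rfl⟩ := hint e l I hI
      exact isPreconnected_Icc.image _ (hγ.continuous_extend _).continuousOn
    have hnt : ∀ A ∈ 𝒮, A.Nontrivial := by
      rintro A ⟨-, e, l, I, hI, rfl⟩
      obtain ⟨hI01, p, q, hpq, rfl⟩ := hint e l I hI
      obtain ⟨z, hpz, hzq⟩ := exists_between hpq
      have hp := hI01 (left_mem_Icc.2 hpq.le)
      have hq := hI01 (right_mem_Icc.2 hpq.le)
      exact ⟨_, ⟨z, ⟨hpz.le, hzq.le⟩, rfl⟩, _, ⟨p, left_mem_Icc.2 hpq.le, rfl⟩, fun h =>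
        hpz.ne' (hγ.eq_of_extend_eq ⟨hp.1.trans_lt hpz, hzq.trans_le hq.2⟩ hp h).2⟩
    have hun : levelBase lev C i = ⋃₀ 𝒮 := by
      refine Subset.antisymm (fun x hx => ?_) (sUnion_subset fun A hA => hA.1)
      obtain ⟨e, s, hs, rfl⟩ := hγ.exists_extend_eq x
      obtain ⟨l, hl, hsl⟩ := (c e).exists_mem_Icc hs
      have hx' := (hbase i e s hs).1 hx
      -- a third that contains `s` and avoids the gaps of its own step lies in the base
      have key : ∀ I ∈ thirds e ⟨l, hl⟩, s ∈ I →
          (∀ j, (c e).g l = some j → (j = i ∨ j + 1 = i) →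
            ∀ z ∈ I, z ∉ Ioo ((c e).a l) ((c e).b l)) → extend (γ e) s ∈ ⋃₀ 𝒮 := by
        intro I hI hsI hgap
        refine ⟨_, ⟨?_, e, ⟨l, hl⟩, I, hI, rfl⟩, ⟨s, hsI, rfl⟩⟩
        rintro _ ⟨z, hz, rfl⟩
        refine (hbase i e z ((hint e _ I hI).1 hz)).2 fun l' hl' j hj hji hzl => ?_
        have hzI : z ∈ Icc ((c e).t l) ((c e).t (l + 1)) := by
          have h1 := (c e).t_lt_a hl
          have h2 := (c e).a_lt_b hl
          have h3 := (c e).b_lt_t hl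
          rcases hI with rfl | rfl | rfl <;> constructor <;> linarith [hz.1, hz.2]
        obtain rfl := (c e).eq_of_mem_Icc hl' hl (Ioo_subset_Icc_self hzl) hzI
        exact hgap j hj hji z hz hzl
      rcases le_or_gt s ((c e).a l) with h | h
      · exact key _ (.inl rfl) ⟨hsl.1, h⟩ fun _ _ _ z hz hz' => not_lt.2 hz.2 hz'.1
      rcases le_or_gt ((c e).b l) s with h' | h'
      · exact key _ (.inr (.inl rfl)) ⟨h', hsl.2⟩ fun _ _ _ z hz hz' => not_lt.2 hz.1 hz'.2
      · exact key _ (.inr (.inr rfl)) ⟨h.le, h'.le⟩ fun j hj hji =>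
          absurd ⟨h, h'⟩ (hx' l hl j hj hji)
    refine ⟨?_, finite_components hfin hpre hun, fun D hD =>
      nontrivial_of_mem_components hpre hnt hun hD⟩
    refine (isOpen_biUnion fun p _ => ?_).isClosed_compl
    rw [hC]; exact hγ.isOpen_image_Ioo _ _ _
  · obtain ⟨x⟩ := ‹Nonempty G›
    obtain ⟨e, -⟩ := hγ.exists_eq x
    refine ⟨extend (γ e) 0, (hbase i e 0 ⟨le_rfl, zero_le_one⟩).2 fun l hl j _ _ h => ?_⟩
    exact ((c e).Icc_subset_Ioo hl (Ioo_subset_Icc_self h)).1.false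
  · obtain ⟨e, s, hs, rfl⟩ := hγ.exists_extend_eq x
    rw [hfF _ _ _ hs]
    exact (c e).exists_height_mem hi hs ((hbase i e s hs).1 hx)

end IsArcDecomposition

end Stairwell

theorem mainTheorem8 {G : Type*} [TopologicalSpace G] [TopologicalSpace.MetrizableSpace G]
    [Nonempty G] (hG : Stairwell.IsGraph G)
    (M U : Set (G × unitInterval))
    (hM : M ⊆ Set.univ ×ˢ Set.Ioo (0 : unitInterval) 1)
    (hsep : Stairwell.Separates M (Set.univ ×ˢ {(0 : unitInterval)})
      (Set.univ ×ˢ {(1 : unitInterval)}))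
    (hU : IsOpen U) (hU' : U ⊆ Set.univ ×ˢ Set.Ioo (0 : unitInterval) 1) (hMU : M ⊆ U) :
    ∃ S : Set (G × unitInterval), S ⊆ U ∧
      ∃ k : ℕ, Odd k ∧ Stairwell.HasStairwellStructure S k := by
  obtain ⟨n, γ, h1, h2, h3⟩ := hG
  have hγ : Stairwell.IsArcDecomposition γ := ⟨h1, h2, h3⟩
  have := hγ.compactSpace
  let := TopologicalSpace.metrizableSpaceMetric G
  obtain ⟨O₀, O₁, hO₀, hO₁, hcov, hdisj, hb, ht⟩ := hsep
  -- a point off `U` lies in exactly one of the open sets `O₀`, `O₁`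
  have hnot : ∀ p ∈ Uᶜ, p ∈ O₀ → p ∉ O₁ := fun p hp h0 h1 =>
    hdisj.le_bot ⟨⟨h0, fun h => hp (hMU h)⟩, h1, fun h => hp (hMU h)⟩
  have hor : ∀ p ∈ Uᶜ, p ∈ O₀ ∨ p ∈ O₁ := by
    intro p hp
    have : p ∈ Mᶜ := fun h => hp (hMU h)
    rw [hcov] at this
    exact this.imp And.left And.left
  have hK : (Uᶜ \ O₁ ∪ Uᶜ \ O₀)ᶜ = U := by
    ext p
    by_cases hp : p ∈ U
    · simp [hp]
    · simp only [Set.mem_compl_iff, Set.mem_union, Set.mem_sdiff, hp, not_false_eq_true, true_and,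
        iff_false, not_not]
      rcases hor p hp with h | h
      exacts [.inl (hnot p hp h), .inr fun h' => hnot p hp h' h]
  have hUb : ∀ x : G, (x, (0 : unitInterval)) ∈ Uᶜ := fun x h => (hU' h).2.1.false
  have hUt : ∀ x : G, (x, (1 : unitInterval)) ∈ Uᶜ := fun x h => (hU' h).2.2.false
  obtain ⟨k, hk, r, hr, w, hw⟩ := Stairwell.exists_heights (K₀ := Uᶜ \ O₁) (K₁ := Uᶜ \ O₀)
    (hU.isClosed_compl.sdiff hO₁).isCompact (hU.isClosed_compl.sdiff hO₀).isCompact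
    (Set.disjoint_left.2 fun p hp hp' => (hor p hp.1).elim hp'.2 hp.2)
    (fun x => ⟨hUb x, hnot _ (hUb x) (hb ⟨trivial, Set.mem_singleton _⟩).1⟩)
    (fun x => ⟨hUt x, fun h => hnot _ (hUt x) h (ht ⟨trivial, Set.mem_singleton _⟩).1⟩)
  rw [hK] at hw
  obtain ⟨S, hSU, hS⟩ := hγ.exists_hasStairwellStructure fun e =>
    (Stairwell.nonempty_stepChain_of_local (hγ.continuous_extend e).continuousOn hr hw).some
  exact ⟨S, hSU, k, hk, hS⟩
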